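/- Let $R$ be an arbitrary (associative, unital) ring. All functors are additive. Let $\mathrm{Mod}(R)$ be the category of right $R$-modules, $\mathrm{mod}(R)$ the full subcategory of finitely presented ones, and view left $R$-modules as $R^{op}$-modules. For $\mathcal C$ one of $\mathrm{Mod}(R)$, $\mathrm{mod}(R)$, $\mathrm{mod}(R^{op})$, let $\mathrm{fp}(\mathcal C,\mathrm{Ab})$ be the category of functors $F:\mathcal C\to\mathrm{Ab}$ admitting an exact sequence $(Y,-)\to(X,-)\to F\to 0$ with $X,Y\in\mathcal C$, and let $(\mathrm{mod}(R^{op}),\mathrm{Ab})$ be the category of all functors $\mathrm{mod}(R^{op})\to\mathrm{Ab}$. A functor $F:\mathrm{Mod}(R)\to\mathrm{Ab}$ is a pp-functor if there is such a sequence with $X,Y\in\mathrm{mod}(R)$; these form the full subcategory $\mathrm{pp}(\mathrm{Mod}(R),\mathrm{Ab})$ of $\mathrm{fp}(\mathrm{Mod}(R),\mathrm{Ab})$. Let $w:\mathrm{fp}(\mathrm{Mod}(R),\mathrm{Ab})\to\mathrm{Mod}(R)$ be the contravariant left adjoint of the Yoneda embedding $X\mapsto (X,-)$, i.e. $\mathrm{Nat}(F,(X,-))\cong(X,wF)$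 naturally, let $t:\mathrm{Mod}(R)\to(\mathrm{mod}(R^{op}),\mathrm{Ab})$, $t(M)=M\otimes_R-$, and let $D_A=R_0(t\circ w):\mathrm{fp}(\mathrm{Mod}(R),\mathrm{Ab})\to(\mathrm{mod}(R^{op}),\mathrm{Ab})$ be the zeroth right derived functor of the contravariant functor $t\circ w$ (so $D_AF=\ker(tw(P_0)\to tw(P_1))$ for a presentation $P_1\to P_0\to F\to 0$ by representables). For $G\in(\mathrm{mod}(R^{op}),\mathrm{Ab})$ and $M\in\mathrm{Mod}(R)$ put $D_RG(M)=\mathrm{Nat}(G,M\otimes_R-)$. Finally let $D$ denote both contravariant functors $DF(L)=\mathrm{Nat}(F,-\otimes_RL)$ for $F:\mathrm{mod}(R)\to\mathrm{Ab}$, $L\in\mathrm{mod}(R^{op})$, and $DG(X)=\mathrm{Nat}(G,X\otimes_R-)$ for $G:\mathrm{mod}(R^{op})\to\mathrm{Ab}$, $X\in\mathrm{mod}(R)$. Then: 1. Restriction along $\mathrm{mod}(R)\subseteq\mathrm{Mod}(R)$ is an equivalence $\rho:\mathrm{pp}(\mathrm{Mod}(R),\mathrm{Ab})\simeq\mathrm{fp}(\mathrm{mod}(R),\mathrm{Ab})$.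 2. $D_R$ takes values in $\mathrm{fp}(\mathrm{Mod}(R),\mathrm{Ab})$, and there is an adjunction $\mathrm{Nat}(F,D_RG)\cong\mathrm{Nat}(G,D_AF)$, natural in $F\in\mathrm{fp}(\mathrm{Mod}(R),\mathrm{Ab})$ and $G\in(\mathrm{mod}(R^{op}),\mathrm{Ab})$, which restricts to the Auslander–Gruson–Jensen duality. That is: $D_A$ sends pp-functors into $\mathrm{fp}(\mathrm{mod}(R^{op}),\mathrm{Ab})$; $D_R$ sends $\mathrm{fp}(\mathrm{mod}(R^{op}),\mathrm{Ab})$ into pp-functors; the canonical maps $F\to D_RD_AF$ and $G\to D_AD_RG$ are isomorphisms for every pp-functor $F$ and every $G\in\mathrm{fp}(\mathrm{mod}(R^{op}),\mathrm{Ab})$; both functors $D$ preserve finitely presented functors; there is a natural isomorphism $D\circ\rho\cong D_A$ on pp-functors, while $\rho\circ D_R=D$ on $\mathrm{fp}(\mathrm{mod}(R^{op}),\mathrm{Ab})$; and under these identifications the restricted adjunction is an adjunction $\mathrm{Nat}(F,DG)\cong\mathrm{Nat}(G,DF)$ between the two functors $D$ on $\mathrm{fp}(\mathrm{mod}(R),\mathrm{Ab})$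 and $\mathrm{fp}(\mathrm{mod}(R^{op}),\mathrm{Ab})$. 3. The functors $D$ are mutually inverse equivalences $\mathrm{fp}(\mathrm{mod}(R),\mathrm{Ab})\simeq\mathrm{fp}(\mathrm{mod}(R^{op}),\mathrm{Ab})^{op}$. -/

import Mathlib

universe w v u

open CategoryTheory Opposite Limits
open scoped TensorProduct

noncomputable section

namespace AGJ

/-! ### Finitely presented modules -/

/-- The property of being a finitely presented module. -/
def isFPMod (S : Type u) [Ring S] : ObjectProperty (ModuleCat.{u} S) :=
  fun M => Module.FinitePresentation S M

/-- The category of finitely presented left `S`-modules. -/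
abbrev FPMod (S : Type u) [Ring S] := (isFPMod S).FullSubcategory

instance (S : Type u) [Ring S] : EssentiallySmall.{u} (FPMod S) :=
  essentiallySmall_of_fully_faithful
    (ObjectProperty.ιOfLE (P := isFPMod S) (P' := ModuleCat.isFG S)
      (fun M hM => by
        have : Module.FinitePresentation S M := hM
        exact (inferInstance : Module.Finite S M)))

/-- The category of right `R`-modules, a right `R`-module being a left module over the opposite
ring. -/
abbrev RMod (R : Type u) [Ring R] := ModuleCat.{u} Rᵐᵒᵖ

/-! ### Additive functors to abelian groups, finite presentation -/

section Functors

variable (C : Type w) [Category.{v} C] [Preadditive C]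

/-- The category of additive functors `C ⥤ Ab`, with all natural transformations. -/
abbrev AddFun := C ⥤+ AddCommGrpCat.{v}

variable {C}

/-- The representable functor `(X, -)`. -/
abbrev rep (X : C) : AddFun C := AdditiveFunctor.of (preadditiveCoyoneda.obj (op X))

/-- The sequence `G' ⟶ G ⟶ F ⟶ 0` of additive functors is exact at every object. -/
def RightExactSeq {G' G F : AddFun C} (g : G' ⟶ G) (p : G ⟶ F) : Prop :=
  ∀ A : C, Function.Exact (g.hom.app A) (p.hom.app A) ∧ Function.Surjective (p.hom.app A)

variable (C) in
/-- `F` is finitely presented: there is an exact sequence `(Y, -) ⟶ (X, -) ⟶ F ⟶ 0`. -/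
def isFPFun : ObjectProperty (AddFun C) :=
  fun F => ∃ (X Y : C) (g : rep Y ⟶ rep X) (p : rep X ⟶ F), RightExactSeq g p

variable (C) in
/-- The category `fp(C, Ab)` of finitely presented functors, with all natural transformations. -/
abbrev FPFun := (isFPFun C).FullSubcategory

lemma isFPFun_rep (X : C) : isFPFun C (rep X) := by
  refine ⟨X, X, 0, 𝟙 _, fun A => ⟨fun y => ?_, fun y => ⟨y, rfl⟩⟩⟩
  constructor
  · intro h
    exact ⟨0, (show (0 : (preadditiveCoyoneda.obj (op X)).obj A) = y from Eq.symm h)⟩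
  · rintro ⟨z, rfl⟩
    rfl

variable (C) in
/-- The contravariant Yoneda embedding `X ↦ (X, -)` into `fp(C, Ab)`. -/
def yon : Cᵒᵖ ⥤ FPFun C :=
  (isFPFun C).lift ((additiveFunctor C AddCommGrpCat.{v}).lift preadditiveCoyoneda
    (fun X => (inferInstance : (preadditiveCoyoneda.obj X).Additive)))
    (fun X => isFPFun_rep X.unop)

instance : (yon C).Additive where
  map_add {X Y f g} := by
    apply ObjectProperty.hom_ext; apply ObjectProperty.hom_ext
    ext A h
    exact Preadditive.add_comp _ _ _ _ _ _

instance : (yon C).Full where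
  map_surjective f := by
    obtain ⟨g, hg⟩ := (preadditiveCoyoneda (C := C)).map_surjective f.hom.hom
    exact ⟨g, ObjectProperty.hom_ext _ (ObjectProperty.hom_ext _ hg)⟩

instance : (yon C).Faithful where
  map_injective h := (preadditiveCoyoneda (C := C)).map_injective
    (congrArg (fun k => InducedCategory.Hom.hom (InducedCategory.Hom.hom k)) h)

/-- A presentation `(Y, -) ⟶ (X, -) ⟶ F ⟶ 0` of `F` by representables, which are the projectives
of `fp(C, Ab)`. -/
structure Pres (F : FPFun C) where
  X : C
  Y : C
  g : (yon C).obj (op Y) ⟶ (yon C).obj (op X)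
  p : (yon C).obj (op X) ⟶ F
  exact : RightExactSeq g.hom p.hom

/-- The chosen presentation. -/
def pres (F : FPFun C) : Pres F :=
  let h₁ := F.property.choose_spec
  let h₂ := h₁.choose_spec
  let h₃ := h₂.choose_spec
  { X := F.property.choose
    Y := h₁.choose
    g := ObjectProperty.homMk h₂.choose
    p := ObjectProperty.homMk h₃.choose
    exact := h₃.choose_spec }

/-- Elements of a finitely presented functor. -/
abbrev FPFun.ev (F : FPFun C) (A : C) : Type v := F.obj.obj.obj A

/-- Components of a natural transformation. -/
abbrev FPFun.app {F G : FPFun C} (α : F ⟶ G) (A : C) : F.ev A → G.ev A := α.hom.hom.app A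

lemma FPFun.ext {F G : FPFun C} {α β : F ⟶ G}
    (h : ∀ A (x : F.ev A), FPFun.app α A x = FPFun.app β A x) : α = β := by
  apply ObjectProperty.hom_ext; apply ObjectProperty.hom_ext
  ext A x
  exact h A x

/-- A natural transformation out of `(A, -)` is determined by its value at the identity. -/
lemma yon_ext {A : C} {F : FPFun C} {α β : (yon C).obj (op A) ⟶ F}
    (h : FPFun.app α A (𝟙 A) = FPFun.app β A (𝟙 A)) : α = β := by
  apply FPFun.ext
  intro B x
  have key : ∀ γ : (yon C).obj (op A) ⟶ F,
      FPFun.app γ B x = F.obj.obj.map x (FPFun.app γ A (𝟙 A)) := by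
    intro γ
    have h1 := ConcreteCategory.congr_hom (γ.hom.hom.naturality x) (𝟙 A)
    have h2 : ((yon C).obj (op A)).obj.obj.map x (𝟙 A) = x := Category.id_comp x
    have h3 : FPFun.app γ B (((yon C).obj (op A)).obj.obj.map x (𝟙 A)) =
      F.obj.obj.map x (FPFun.app γ A (𝟙 A)) := h1
    rw [h2] at h3
    exact h3
  rw [key, key, h]

namespace Pres

variable {F : FPFun C} (P : Pres F)

lemma w : P.g ≫ P.p = 0 :=
  FPFun.ext fun A x => (P.exact A).1.apply_apply_eq_zero x

lemma exists_lift {A : C} (β : (yon C).obj (op A) ⟶ F) :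
    ∃ γ : (yon C).obj (op A) ⟶ (yon C).obj (op P.X), γ ≫ P.p = β := by
  obtain ⟨x, hx⟩ := (P.exact A).2 (FPFun.app β A (𝟙 A))
  refine ⟨(yon C).map (Quiver.Hom.op (x : P.X ⟶ A)), yon_ext ?_⟩
  rw [← hx]
  exact congrArg (FPFun.app P.p A) (Category.comp_id (x : P.X ⟶ A))

lemma exists_lift' {A : C} (β : (yon C).obj (op A) ⟶ (yon C).obj (op P.X)) (h : β ≫ P.p = 0) :
    ∃ γ : (yon C).obj (op A) ⟶ (yon C).obj (op P.Y), γ ≫ P.g = β := by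
  have h0 : FPFun.app P.p A (FPFun.app β A (𝟙 A)) = 0 :=
    congrArg (fun γ : (yon C).obj (op A) ⟶ F => FPFun.app γ A (𝟙 A)) h
  obtain ⟨x, hx⟩ := ((P.exact A).1 _).1 h0
  refine ⟨(yon C).map (Quiver.Hom.op (x : P.Y ⟶ A)), yon_ext ?_⟩
  rw [← hx]
  exact congrArg (FPFun.app P.g A) (Category.comp_id (x : P.Y ⟶ A))

lemma p_epi {H : FPFun C} {α β : F ⟶ H} (h : P.p ≫ α = P.p ≫ β) : α = β := by
  apply FPFun.ext
  intro A x
  obtain ⟨y, rfl⟩ := (P.exact A).2 x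
  exact congrArg (fun γ : (yon C).obj (op P.X) ⟶ H => FPFun.app γ A y) h

lemma exists_desc {H : FPFun C} (β : (yon C).obj (op P.X) ⟶ H) (h : P.g ≫ β = 0) :
    ∃ α : F ⟶ H, P.p ≫ α = β := by
  have hker : ∀ A, (P.p.hom.hom.app A).hom.ker ≤ (β.hom.hom.app A).hom.ker := by
    intro A x hx
    obtain ⟨y, rfl⟩ := ((P.exact A).1 x).1 hx
    exact congrArg (fun γ : (yon C).obj (op P.Y) ⟶ H => FPFun.app γ A y) h
  let a : ∀ A, F.ev A →+ H.ev A := fun A =>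
    AddMonoidHom.liftOfRightInverse (P.p.hom.hom.app A).hom
      (Function.surjInv (P.exact A).2) (Function.rightInverse_surjInv (P.exact A).2)
      ⟨(β.hom.hom.app A).hom, hker A⟩
  have ha : ∀ A x, a A (FPFun.app P.p A x) = FPFun.app β A x := fun A x =>
    AddMonoidHom.liftOfRightInverse_comp_apply _ _ _ _ x
  refine ⟨ObjectProperty.homMk (ObjectProperty.homMk
    { app := fun A => AddCommGrpCat.ofHom (a A)
      naturality := ?_ }), FPFun.ext ha⟩
  intro A B f
  ext x
  obtain ⟨y, rfl⟩ := (P.exact A).2 x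
  have h1 : F.obj.obj.map f (FPFun.app P.p A y) =
      FPFun.app P.p B (((yon C).obj (op P.X)).obj.obj.map f y) :=
    (ConcreteCategory.congr_hom (P.p.hom.hom.naturality f) y).symm
  have h2 : H.obj.obj.map f (FPFun.app β A y) =
      FPFun.app β B (((yon C).obj (op P.X)).obj.obj.map f y) :=
    (ConcreteCategory.congr_hom (β.hom.hom.naturality f) y).symm
  change a B (F.obj.obj.map f (FPFun.app P.p A y)) = H.obj.obj.map f (a A (FPFun.app P.p A y))
  rw [h1, ha, ha, h2]

/-- The map `X ⟶ Y` inducing `(Y, -) ⟶ (X, -)`. -/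
def f : P.X ⟶ P.Y := ((yon C).preimage P.g).unop

lemma map_f : (yon C).map P.f.op = P.g := (yon C).map_preimage P.g

end Pres

/-! ### The left adjoint `w` of the Yoneda embedding -/

section W

variable [HasKernels C]

/-- The map `Nat(F, (A, -)) → (A, ker f)`. -/
def toKer (F : FPFun C) (A : Cᵒᵖ) (α : F ⟶ (yon C).obj A) : op (kernel (pres F).f) ⟶ A :=
  (kernel.lift (pres F).f ((yon C).preimage ((pres F).p ≫ α)).unop (by
    apply Quiver.Hom.op_inj
    apply (yon C).map_injective
    rw [op_comp, Functor.map_comp, Pres.map_f, Quiver.Hom.op_unop, Functor.map_preimage,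
      ← Category.assoc, Pres.w, zero_comp, op_zero, Functor.map_zero])).op

lemma toKer_ι (F : FPFun C) (A : Cᵒᵖ) (α : F ⟶ (yon C).obj A) :
    (yon C).map ((toKer F A α).unop ≫ kernel.ι _).op = (pres F).p ≫ α := by
  rw [toKer, Quiver.Hom.unop_op, kernel.lift_ι, Quiver.Hom.op_unop, Functor.map_preimage]

lemma ker_ext {F : FPFun C} {A : Cᵒᵖ} {h k : op (kernel (pres F).f) ⟶ A}
    (e : (yon C).map (h.unop ≫ kernel.ι _).op = (yon C).map (k.unop ≫ kernel.ι _).op) :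
    h = k := by
  apply Quiver.Hom.unop_inj
  rw [← cancel_mono (kernel.ι _)]
  exact Quiver.Hom.op_inj ((yon C).map_injective e)

lemma toKer_bijective (F : FPFun C) (A : Cᵒᵖ) : Function.Bijective (toKer F A) := by
  constructor
  · intro α β h
    apply (pres F).p_epi
    rw [← toKer_ι, h, toKer_ι]
  · intro k
    obtain ⟨α, hα⟩ := (pres F).exists_desc ((yon C).map (k.unop ≫ kernel.ι _).op) (by
      rw [← Pres.map_f, ← Functor.map_comp, ← op_comp, Category.assoc, kernel.condition,
        comp_zero, op_zero, Functor.map_zero])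
    exact ⟨α, ker_ext (by rw [toKer_ι, hα])⟩

/-- The natural bijection `(A, ker f) ≃ Nat(F, (A, -))`. -/
def wEquiv (F : FPFun C) (A : Cᵒᵖ) :
    (op (kernel (pres F).f) ⟶ A) ≃ (F ⟶ (yon C).obj A) :=
  (Equiv.ofBijective (toKer F A) (toKer_bijective F A)).symm

lemma wEquiv_naturality (F : FPFun C) (A B : Cᵒᵖ) (g : A ⟶ B)
    (h : op (kernel (pres F).f) ⟶ A) :
    wEquiv F B (h ≫ g) = wEquiv F A h ≫ (yon C).map g := by
  obtain ⟨α, rfl⟩ := (toKer_bijective F A).2 h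
  have h1 : wEquiv F A (toKer F A α) = α :=
    (Equiv.ofBijective (toKer F A) (toKer_bijective F A)).symm_apply_apply α
  rw [h1, wEquiv, Equiv.symm_apply_eq]
  apply ker_ext
  change _ = (yon C).map ((toKer F B (α ≫ (yon C).map g)).unop ≫ kernel.ι _).op
  rw [toKer_ι, unop_comp, Category.assoc, op_comp, Functor.map_comp, toKer_ι, Category.assoc]
  rfl

variable (C) in
/-- The functor `w`, left adjoint to the Yoneda embedding; on objects, `w F` is the kernel of the
map `X ⟶ Y` of a presentation `(Y, -) ⟶ (X, -) ⟶ F ⟶ 0`. -/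
def w : FPFun C ⥤ Cᵒᵖ := 
  Adjunction.leftAdjointOfEquiv (G := yon C) wEquiv wEquiv_naturality

variable (C) in
/-- The adjunction `Nat(F, (X, -)) ≅ (X, w F)`. -/
def wAdj : w C ⊣ yon C := 
  Adjunction.adjunctionOfEquivLeft (G := yon C) wEquiv wEquiv_naturality

instance : (w C).Additive := (wAdj C).left_adjoint_additive

end W

/-! ### The zeroth right derived functor of a contravariant functor on `fp(C, Ab)` -/

section R0

variable {B : Type*} [Category* B] [Preadditive B] [HasKernels B]
  (S : (FPFun C)ᵒᵖ ⥤ B)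

/-- The map on zeroth cohomology induced by a lift `a` of a morphism to presentations. -/
lemma R0_aux {F G : FPFun C} (P : Pres F) (Q : Pres G) (α : F ⟶ G)
    (a : (yon C).obj (op P.X) ⟶ (yon C).obj (op Q.X)) (ha : a ≫ Q.p = P.p ≫ α) :
    (kernel.ι (S.map Q.g.op) ≫ S.map a.op) ≫ S.map P.g.op = 0 := by
  obtain ⟨b, hb⟩ := Q.exists_lift' (P.g ≫ a) (by
    rw [Category.assoc, ha, ← Category.assoc, P.w, zero_comp])
  rw [Category.assoc, ← S.map_comp, ← op_comp, ← hb, op_comp, S.map_comp, ← Category.assoc,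
    kernel.condition, zero_comp]

variable [S.Additive]

lemma R0_indep {F G : FPFun C} (P : Pres F) (Q : Pres G)
    (a b : (yon C).obj (op P.X) ⟶ (yon C).obj (op Q.X)) (h : a ≫ Q.p = b ≫ Q.p) :
    kernel.ι (S.map Q.g.op) ≫ S.map a.op = kernel.ι (S.map Q.g.op) ≫ S.map b.op := by
  obtain ⟨c, hc⟩ := Q.exists_lift' (a - b) (by rw [Preadditive.sub_comp, h, sub_self])
  rw [← sub_eq_zero, ← Preadditive.comp_sub, ← S.map_sub, ← op_sub, ← hc, op_comp, S.map_comp,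
    ← Category.assoc, kernel.condition, zero_comp]

/-- `R₀ S`: apply the contravariant functor `S` to a projective presentation `P₁ ⟶ P₀ ⟶ F ⟶ 0`
and take the kernel of `S P₀ ⟶ S P₁`; a morphism acts through any lift to the presentations. -/
def R0 : (FPFun C)ᵒᵖ ⥤ B where
  obj F := kernel (S.map (pres F.unop).g.op)
  map {G F} α := kernel.lift _ _ (R0_aux S (pres F.unop) (pres G.unop) α.unop _
    ((pres G.unop).exists_lift ((pres F.unop).p ≫ α.unop)).choose_spec)
  map_id F := by
    rw [← cancel_mono (kernel.ι _), kernel.lift_ι, Category.id_comp]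
    refine (R0_indep S (pres F.unop) (pres F.unop) _ (𝟙 _) ?_).trans ?_
    · rw [((pres F.unop).exists_lift ((pres F.unop).p ≫ (𝟙 F : F ⟶ F).unop)).choose_spec]
      simp
    · simp
  map_comp {H G F} α β := by
    rw [← cancel_mono (kernel.ι _), kernel.lift_ι, Category.assoc, kernel.lift_ι,
      ← Category.assoc, kernel.lift_ι, Category.assoc, ← S.map_comp, ← op_comp]
    apply R0_indep S (pres F.unop) (pres H.unop)
    rw [((pres H.unop).exists_lift ((pres F.unop).p ≫ (α ≫ β).unop)).choose_spec,
      Category.assoc, ((pres H.unop).exists_lift ((pres G.unop).p ≫ α.unop)).choose_spec,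
      ← Category.assoc, ((pres G.unop).exists_lift ((pres F.unop).p ≫ β.unop)).choose_spec,
      Category.assoc, unop_comp]

end R0

/-! ### Kernels of additive functors -/

instance : (additiveFunctor C AddCommGrpCat.{u}).IsClosedUnderSubobjects where
  prop_of_mono {F G} i _ hG := by
    have : G.Additive := hG
    refine (additiveFunctor_iff F).2 ⟨fun {X Y f g} => ?_⟩
    rw [← cancel_mono (i.app Y), Preadditive.add_comp]
    simp only [i.naturality, G.map_add, Preadditive.comp_add]

instance : HasKernels (C ⥤+ AddCommGrpCat.{u}) := inferInstance

end Functors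

/-! ### The tensor product over a noncommutative ring -/

section Tensor

variable {R : Type u} [Ring R]

/-- The relations `(x r) ⊗ l = x ⊗ (r l)`. -/
def balanced (X : Type u) [AddCommGroup X] [Module Rᵐᵒᵖ X] (L : Type u) [AddCommGroup L]
    [Module R L] : AddSubgroup (X ⊗[ℤ] L) :=
  AddSubgroup.closure
    {t | ∃ (x : X) (r : R) (l : L), t = (MulOpposite.op r • x) ⊗ₜ[ℤ] l - x ⊗ₜ[ℤ] (r • l)}

/-- The abelian group `X ⊗_R L`, for a right module `X` and a left module `L`. -/
def tensor (X : RMod R) (L : ModuleCat.{u} R) : AddCommGrpCat.{u} :=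
  AddCommGrpCat.of ((X ⊗[ℤ] L) ⧸ balanced (R := R) X L)

/-- The pure tensor `x ⊗ l`. -/
def tmul {X : RMod R} {L : ModuleCat.{u} R} (x : X) (l : L) : tensor X L :=
  QuotientAddGroup.mk (x ⊗ₜ[ℤ] l)

lemma tensor_ext {X : RMod R} {L : ModuleCat.{u} R} {A : AddCommGrpCat.{u}}
    {φ ψ : tensor X L ⟶ A} (h : ∀ x l, φ (tmul x l) = ψ (tmul x l)) : φ = ψ := by
  apply AddCommGrpCat.hom_ext
  apply QuotientAddGroup.addMonoidHom_ext
  apply AddMonoidHom.ext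
  intro t
  induction t using TensorProduct.induction_on with
  | zero => simp
  | tmul x l => exact h x l
  | add a b ha hb => rw [map_add, map_add, ha, hb]

/-- The map `f ⊗ g`. -/
def tensorMap {X X' : RMod R} {L L' : ModuleCat.{u} R} (f : X ⟶ X') (g : L ⟶ L') :
    tensor X L ⟶ tensor X' L' :=
  AddCommGrpCat.ofHom <| QuotientAddGroup.map (balanced (R := R) X L) (balanced (R := R) X' L')
    (TensorProduct.map f.hom.toAddMonoidHom.toIntLinearMap
      g.hom.toAddMonoidHom.toIntLinearMap).toAddMonoidHom (by
    rw [balanced, AddSubgroup.closure_le]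
    rintro _ ⟨x, r, l, rfl⟩
    apply AddSubgroup.subset_closure
    refine ⟨f x, r, g l, ?_⟩
    simp [TensorProduct.map_tmul])

@[simp]
lemma tensorMap_tmul {X X' : RMod R} {L L' : ModuleCat.{u} R} (f : X ⟶ X') (g : L ⟶ L')
    (x : X) (l : L) : tensorMap f g (tmul x l) = tmul (f x) (g l) := rfl

lemma tmul_add {X : RMod R} {L : ModuleCat.{u} R} (x : X) (l l' : L) :
    tmul x (l + l') = tmul x l + tmul x l' :=
  congrArg QuotientAddGroup.mk (TensorProduct.tmul_add x l l')

lemma add_tmul {X : RMod R} {L : ModuleCat.{u} R} (x x' : X) (l : L) :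
    tmul (x + x') l = tmul x l + tmul x' l :=
  congrArg QuotientAddGroup.mk (TensorProduct.add_tmul x x' l)

variable (R) in
/-- The tensor product as a functor of both variables. -/
def tensorFunctor : RMod R ⥤ ModuleCat.{u} R ⥤ AddCommGrpCat.{u} where
  obj X :=
    { obj L := tensor X L
      map g := tensorMap (𝟙 X) g
      map_id L := tensor_ext fun _ _ => rfl
      map_comp f g := tensor_ext fun _ _ => rfl }
  map f :=
    { app L := tensorMap f (𝟙 L)
      naturality _ _ g := tensor_ext fun _ _ => rfl }
  map_id X := by
    ext L : 2
    exact tensor_ext fun _ _ => rfl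
  map_comp f g := by
    ext L : 2
    exact tensor_ext fun _ _ => rfl

instance (X : RMod R) : ((tensorFunctor R).obj X).Additive where
  map_add {_ _ f g} := tensor_ext fun x l => tmul_add x (f l) (g l)

instance : (tensorFunctor R).Additive where
  map_add {_ _ f g} := by
    ext L : 2
    exact tensor_ext fun x l => add_tmul (f x) (g x) l

instance (L : ModuleCat.{u} R) : ((tensorFunctor R).flip.obj L).Additive where
  map_add {_ _ f g} := tensor_ext fun x l => add_tmul (f x) (g x) l

instance : (tensorFunctor R).flip.Additive where
  map_add {_ _ f g} := by
    ext X : 2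
    exact tensor_ext fun x l => tmul_add x (f l) (g l)

variable (R) in
/-- The tensor embedding `t : Mod(R) ⥤ (mod(Rᵒᵖ), Ab)`, `X ↦ X ⊗ -`. -/
def tR : RMod R ⥤ AddFun (FPMod R) :=
  (additiveFunctor _ _).lift
    (tensorFunctor R ⋙ (Functor.whiskeringLeft _ _ _).obj (isFPMod R).ι)
    (fun X => (inferInstance : ((isFPMod R).ι ⋙ (tensorFunctor R).obj X).Additive))

variable (R) in
/-- The functor `mod(Rᵒᵖ) ⥤ (mod(R), Ab)`, `L ↦ - ⊗ L`. -/
def tL : FPMod R ⥤ AddFun (FPMod Rᵐᵒᵖ) :=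
  (additiveFunctor _ _).lift
    ((isFPMod R).ι ⋙ (tensorFunctor R).flip ⋙
      (Functor.whiskeringLeft _ _ _).obj (isFPMod Rᵐᵒᵖ).ι)
    (fun L => (inferInstance :
      ((isFPMod Rᵐᵒᵖ).ι ⋙ (tensorFunctor R).flip.obj ((isFPMod R).ι.obj L)).Additive))

instance : (tR R).Additive where
  map_add {_ _ f g} := by
    apply ObjectProperty.hom_ext
    ext L : 2
    exact tensor_ext fun x l => add_tmul (f x) (g x) l

instance : (tL R).Additive where
  map_add {_ _ f g} := by
    apply ObjectProperty.hom_ext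
    ext X : 2
    exact tensor_ext fun x l => tmul_add x (f.hom l) (g.hom l)

end Tensor

/-! ### The functors `G ↦ (k ↦ Nat(G, T k))` -/

section NatDual

variable {J : Type w} [Category.{u} J] [Preadditive J] [EssentiallySmall.{u} J]

instance small_nat (G H : AddFun J) : Small.{u} (G ⟶ H) := by
  let Φ : (G ⟶ H) → ∀ s : SmallModel.{u} J,
      (G.obj.obj ((equivSmallModel.{u} J).inverse.obj s) →
        H.obj.obj ((equivSmallModel.{u} J).inverse.obj s)) :=
    fun α s => α.hom.app _
  refine small_of_injective (f := Φ) fun α β h => ?_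
  apply ObjectProperty.hom_ext
  ext A : 2
  let i := (equivSmallModel.{u} J).unitIso.app A
  have h1 : α.hom.app ((equivSmallModel.{u} J).inverse.obj
      ((equivSmallModel.{u} J).functor.obj A)) = β.hom.app _ := by
    ext x
    exact congrFun (congrFun h ((equivSmallModel.{u} J).functor.obj A)) x
  rw [← cancel_mono (H.obj.map i.hom), ← NatTrans.naturality, ← NatTrans.naturality]
  exact congrArg (G.obj.map i.hom ≫ ·) h1

variable {K : Type v} [Category.{u} K] [Preadditive K] (T : K ⥤ AddFun J) [T.Additive]

/-- The group `Nat(G, H)`, replaced by an isomorphic group in the smaller universe. -/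
def natGrp (G H : AddFun J) : AddCommGrpCat.{u} := AddCommGrpCat.of (Shrink.{u} (G ⟶ H))

/-- `Nat(G, H) ≃ natGrp G H`. -/
def natGrpEquiv (G H : AddFun J) : (G ⟶ H) ≃+ natGrp G H := Shrink.addEquiv.symm

/-- The map `Nat(G, H) ⟶ Nat(G', H')` induced by `a : G' ⟶ G` and `b : H ⟶ H'`. -/
def natGrpMap {G G' H H' : AddFun J} (a : G' ⟶ G) (b : H ⟶ H') :
    natGrp G H ⟶ natGrp G' H' :=
  AddCommGrpCat.ofHom <| ((natGrpEquiv G' H').toAddMonoidHom.comp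
    ((Preadditive.leftComp H' a).comp (Preadditive.rightComp G b))).comp
      (natGrpEquiv G H).symm.toAddMonoidHom

lemma natGrpMap_apply {G G' H H' : AddFun J} (a : G' ⟶ G) (b : H ⟶ H') (φ : G ⟶ H) :
    natGrpMap a b (natGrpEquiv G H φ) = natGrpEquiv G' H' (a ≫ φ ≫ b) := by
  change natGrpEquiv G' H' (a ≫ ((natGrpEquiv G H).symm (natGrpEquiv G H φ)) ≫ b) = _
  rw [AddEquiv.symm_apply_apply]

lemma natGrp_ext {G H : AddFun J} {A : AddCommGrpCat.{u}} {f g : natGrp G H ⟶ A}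
    (h : ∀ φ : G ⟶ H, f (natGrpEquiv G H φ) = g (natGrpEquiv G H φ)) : f = g := by
  ext x
  obtain ⟨φ, rfl⟩ := (natGrpEquiv G H).surjective x
  exact h φ

lemma natGrpMap_id (G H : AddFun J) : natGrpMap (𝟙 G) (𝟙 H) = 𝟙 (natGrp G H) :=
  natGrp_ext fun φ => by
    rw [natGrpMap_apply, Category.id_comp, Category.comp_id]
    rfl

lemma natGrpMap_comp {G G' G'' H H' H'' : AddFun J} (a : G' ⟶ G) (b : H ⟶ H') (a' : G'' ⟶ G')
    (b' : H' ⟶ H'') : natGrpMap a b ≫ natGrpMap a' b' = natGrpMap (a' ≫ a) (b ≫ b') :=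
  natGrp_ext fun φ => by
    refine (congrArg (natGrpMap a' b') (natGrpMap_apply a b φ)).trans ?_
    rw [natGrpMap_apply, natGrpMap_apply]
    simp only [Category.assoc]

lemma natGrpMap_add {G H H' : AddFun J} (b b' : H ⟶ H') :
    natGrpMap (𝟙 G) (b + b') = natGrpMap (𝟙 G) b + natGrpMap (𝟙 G) b' :=
  natGrp_ext fun φ => by
    refine (natGrpMap_apply _ _ φ).trans ?_
    refine Eq.trans ?_ (congrArg₂ (· + ·) (natGrpMap_apply (𝟙 G) b φ)
      (natGrpMap_apply (𝟙 G) b' φ)).symm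
    rw [Preadditive.comp_add, Preadditive.comp_add, map_add]

/-- The additive functor `k ↦ Nat(G, T k)`. -/
def natDualObj (G : AddFun J) : AddFun K where
  obj :=
    { obj k := natGrp G (T.obj k)
      map f := natGrpMap (𝟙 G) (T.map f)
      map_id k := by rw [T.map_id, natGrpMap_id]
      map_comp f g := by rw [natGrpMap_comp, T.map_comp, Category.id_comp] }
  property :=
    { map_add {X Y f g} := by
        change natGrpMap _ (T.map (f + g)) = _
        rw [T.map_add, natGrpMap_add] }

/-- The contravariant functor `G ↦ (k ↦ Nat(G, T k))`. -/
def natDual : (AddFun J)ᵒᵖ ⥤ AddFun K where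
  obj G := natDualObj T G.unop
  map a := ObjectProperty.homMk
    { app k := natGrpMap a.unop (𝟙 (T.obj k))
      naturality k l f := by
        change natGrpMap _ _ ≫ natGrpMap _ _ = natGrpMap _ _ ≫ natGrpMap _ _
        simp only [natGrpMap_comp, Category.id_comp, Category.comp_id] }
  map_id G := by
    apply ObjectProperty.hom_ext
    ext k : 2
    exact natGrpMap_id _ _
  map_comp a b := by
    apply ObjectProperty.hom_ext
    ext k : 2
    change natGrpMap _ _ = natGrpMap _ _ ≫ natGrpMap _ _
    rw [natGrpMap_comp, unop_comp, Category.id_comp]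

end NatDual

/-! ### The functors of the theory -/

section Main

variable (R : Type u) [Ring R]

/-- The Auslander–Gruson–Jensen functor `D_A = R₀(t ∘ w)`. -/
def DA : (FPFun (RMod R))ᵒᵖ ⥤ AddFun (FPMod R) := R0 ((w (RMod R)).leftOp ⋙ tR R)

/-- The functor `D_R G (M) = Nat(G, M ⊗ -)`, with values in all additive functors. -/
def DR : (AddFun (FPMod R))ᵒᵖ ⥤ AddFun (RMod R) := natDual (tR R)

/-- The functor `D_R`, as a functor to finitely presented functors. -/
def DRfp (h : ∀ G, isFPFun (RMod R) ((DR R).obj G)) :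
    (AddFun (FPMod R))ᵒᵖ ⥤ FPFun (RMod R) :=
  (isFPFun (RMod R)).lift (DR R) h

/-- `F` is a pp-functor: there is an exact sequence `(Y, -) ⟶ (X, -) ⟶ F ⟶ 0` with `X`, `Y`
finitely presented modules. -/
def isPP : ObjectProperty (AddFun (RMod R)) := fun F =>
  ∃ (X Y : FPMod Rᵐᵒᵖ) (g : rep Y.obj ⟶ rep X.obj) (p : rep X.obj ⟶ F), RightExactSeq g p

/-- The category `pp(Mod(R), Ab)` of pp-functors. -/
abbrev PP := (isPP R).FullSubcategory

/-- The inclusion of pp-functors into finitely presented functors. -/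
def ppIncl : PP R ⥤ FPFun (RMod R) :=
  ObjectProperty.ιOfLE (fun _ ⟨X, Y, g, p, h⟩ => ⟨X.obj, Y.obj, g, p, h⟩)

/-- Restriction of functors along `mod(R) ⊆ Mod(R)`. -/
def res : AddFun (RMod R) ⥤ AddFun (FPMod Rᵐᵒᵖ) :=
  (additiveFunctor _ _).lift (AdditiveFunctor.forget _ _ ⋙
      (Functor.whiskeringLeft _ _ _).obj (isFPMod Rᵐᵒᵖ).ι)
    (fun F => (inferInstance : ((isFPMod Rᵐᵒᵖ).ι ⋙ F.obj).Additive))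

/-- Restriction of a representable functor with finitely presented `X`. -/
def resRep (X : FPMod Rᵐᵒᵖ) : (res R).obj (rep X.obj) ≅ rep X :=
  ObjectProperty.isoMk _ (NatIso.ofComponents (fun A =>
    AddEquiv.toAddCommGrpIso
      { toFun := fun (h : X.obj ⟶ A.obj) => (ObjectProperty.homMk h : X ⟶ A)
        invFun := fun (h : X ⟶ A) => h.hom
        left_inv := fun _ => rfl
        right_inv := fun _ => rfl
        map_add' := fun _ _ => rfl }) (fun _ => rfl))

lemma isFPFun_res (F : PP R) : isFPFun (FPMod Rᵐᵒᵖ) ((res R).obj F.obj) := by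
  obtain ⟨X, Y, g, p, h⟩ := F.property
  refine ⟨X, Y, (resRep R Y).inv ≫ (res R).map g ≫ (resRep R X).hom,
    (resRep R X).inv ≫ (res R).map p, fun A => ⟨fun x => ?_, fun x => ?_⟩⟩
  · refine ((h A.obj).1 x.hom).trans ?_
    constructor
    · rintro ⟨y, hy⟩
      exact ⟨ObjectProperty.homMk y, congrArg ObjectProperty.homMk hy⟩
    · rintro ⟨y, hy⟩
      exact ⟨y.hom, congrArg InducedCategory.Hom.hom hy⟩
  · obtain ⟨y, hy⟩ := (h A.obj).2 x
    exact ⟨ObjectProperty.homMk y, hy⟩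

/-- The restriction functor `pp(Mod(R), Ab) ⥤ fp(mod(R), Ab)`. -/
def ppRes : PP R ⥤ FPFun (FPMod Rᵐᵒᵖ) :=
  (isFPFun _).lift ((isPP R).ι ⋙ res R) (isFPFun_res R)

/-- The classical functor `D F (L) = Nat(F, - ⊗ L)` for `F : mod(R) ⥤ Ab`. -/
def D : (AddFun (FPMod Rᵐᵒᵖ))ᵒᵖ ⥤ AddFun (FPMod R) := natDual (tL R)

/-- The classical functor `D G (X) = Nat(G, X ⊗ -)` for `G : mod(Rᵒᵖ) ⥤ Ab`. -/
def D' : (AddFun (FPMod R))ᵒᵖ ⥤ AddFun (FPMod Rᵐᵒᵖ) := natDual ((isFPMod Rᵐᵒᵖ).ι ⋙ tR R)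

/-- `D` on finitely presented functors. -/
def Dfp (h : ∀ F : FPFun (FPMod Rᵐᵒᵖ), isFPFun (FPMod R) ((D R).obj (op F.obj))) :
    (FPFun (FPMod Rᵐᵒᵖ))ᵒᵖ ⥤ FPFun (FPMod R) :=
  (isFPFun _).lift ((isFPFun _).ι.op ⋙ D R) (fun F => h F.unop)

/-- `D'` on finitely presented functors. -/
def D'fp (h : ∀ G : FPFun (FPMod R), isFPFun (FPMod Rᵐᵒᵖ) ((D' R).obj (op G.obj))) :
    (FPFun (FPMod R))ᵒᵖ ⥤ FPFun (FPMod Rᵐᵒᵖ) :=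
  (isFPFun _).lift ((isFPFun _).ι.op ⋙ D' R) (fun G => h G.unop)

/-- The restriction of `D_A` to a functor from pp-functors to finitely presented functors. -/
def DApp (h : ∀ F : PP R, isFPFun (FPMod R) ((DA R).obj (op ((ppIncl R).obj F)))) :
    (PP R)ᵒᵖ ⥤ FPFun (FPMod R) :=
  (isFPFun _).lift ((ppIncl R).op ⋙ DA R) (fun F => h F.unop)

/-- The restriction of `D_R` to a functor from finitely presented functors to pp-functors. -/
def DRpp (h : ∀ G : FPFun (FPMod R), isPP R ((DR R).obj (op G.obj))) :
    (FPFun (FPMod R))ᵒᵖ ⥤ PP R :=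
  (isPP R).lift ((isFPFun _).ι.op ⋙ DR R) (fun G => h G.unop)

/-- Restricting the values of `D_R` from `Mod(R)` to `mod(R)` gives the classical functor. -/
def resDRpp (h : ∀ G : FPFun (FPMod R), isPP R ((DR R).obj (op G.obj)))
    (h' : ∀ G : FPFun (FPMod R), isFPFun (FPMod Rᵐᵒᵖ) ((D' R).obj (op G.obj))) :
    DRpp R h ⋙ ppRes R ≅ D'fp R h' :=
  Iso.refl _

end Main

end AGJ

end

noncomputable section

namespace AGJ

/-! Write `T` for one of the tensor embeddings, `X ↦ X ⊗ -` or `L ↦ - ⊗ L`; it is fully faithful and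
each `T k` is right exact. If `F` is the cokernel of `(Y, -) ⟶ (X, -)`, then `Nat(F, H)` is the
kernel of `H X ⟶ H Y` by Yoneda. So the dual of a finitely presented functor is the kernel of a map
of tensor functors, for instance `D F = ker (X ⊗ - ⟶ Y ⊗ -)`. Tensoring with a finitely presented
module is a finitely presented functor, because `- ⊗ Rⁿ ≅ (Rⁿ, -)`. Finitely presented functors are
closed under kernels because (weak) pushouts of modules exist (`relFP_of_ker`), so all the duals are
finitely presented. For arbitrary `G` the functor `D_R G` is a kernel between small products of
functors `- ⊗ L`, and products are harmless because `Mod(R)` has coproducts.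

Biduality rests on relative injectivity: maps into a right exact functor extend along monomorphisms
with finitely presented cokernel (`exists_extension`). With `E = ker (T X ⟶ T Y)`, this makes `Nat(T
Y, T k) ⟶ Nat(T X, T k) ⟶ Nat(E, T k) ⟶ 0` exact. By full faithfulness its first map is `(Y, k) ⟶
(X, k)`, whose cokernel is `F k`. This is `bijective_of_pairing`, used for `F ⟶ D' D F`, `G ⟶ D D'
G` and `F ⟶ D_R D_A F`.

The functor `D_A` fits in through `D_A F (L) ≅ Nat(F, - ⊗ L)`, natural transformations on all
modules (`bijective_theta`): the two sides agree on representables, and both turn presentations into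
kernels. Hence `Nat(F, D_R G)` and `Nat(G, D_A F)` both consist of the natural biadditive pairings
`F M × G L → M ⊗ L`, and the adjunction exchanges the two arguments. The classical adjunction is the
same exchange over finitely presented `M`. Transformations out of a pp-functor are determined by
their restriction to finitely presented modules (`bijective_res_map`), so `D_A` becomes `D` on
pp-functors. The comparison of adjunctions is then an equality of pairings. -/

/-! ### Additive functors in terms of elements -/

section Elements

variable {C : Type w} [Category.{v} C] [Preadditive C] {F G H K : AddFun C}

/-- The elements of an additive functor at an object. -/
abbrev ev (F : AddFun C) (A : C) : Type v := F.obj.obj A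

/-- The component of a natural transformation as a homomorphism of groups. -/
def app (α : F ⟶ G) (A : C) : ev F A →+ ev G A := (α.hom.app A).hom

/-- The action of a morphism on the elements of an additive functor. -/
def act (F : AddFun C) {A B : C} (f : A ⟶ B) : ev F A →+ ev F B := (F.obj.map f).hom

/-- A natural transformation given by homomorphisms of groups. -/
def mkNat (a : ∀ A, ev F A →+ ev G A)
    (h : ∀ {A B} (f : A ⟶ B) x, a B (act F f x) = act G f (a A x)) : F ⟶ G :=
  ObjectProperty.homMk
    { app A := AddCommGrpCat.ofHom (a A)
      naturality A B f := by
        ext x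
        exact h f x }

@[simp]
lemma app_id (A : C) (x : ev F A) : app (𝟙 F) A x = x := rfl

@[simp]
lemma app_comp (α : F ⟶ G) (β : G ⟶ H) (A : C) (x : ev F A) :
    app (α ≫ β) A x = app β A (app α A x) := rfl

@[simp]
lemma app_add (α β : F ⟶ G) (A : C) (x : ev F A) :
    app (α + β) A x = app α A x + app β A x := rfl

@[simp]
lemma app_zero (A : C) (x : ev F A) : app (0 : F ⟶ G) A x = 0 := rfl

lemma app_act (α : F ⟶ G) {A B : C} (f : A ⟶ B) (x : ev F A) :
    app α B (act F f x) = act G f (app α A x) :=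
  ConcreteCategory.congr_hom (α.hom.naturality f) x

@[simp]
lemma act_id (A : C) (x : ev F A) : act F (𝟙 A) x = x :=
  ConcreteCategory.congr_hom (F.obj.map_id A) x

lemma act_comp {A B D : C} (f : A ⟶ B) (g : B ⟶ D) (x : ev F A) :
    act F (f ≫ g) x = act F g (act F f x) :=
  ConcreteCategory.congr_hom (F.obj.map_comp f g) x

lemma act_add {A B : C} (f g : A ⟶ B) (x : ev F A) :
    act F (f + g) x = act F f x + act F g x := by
  have : F.obj.Additive := F.property
  exact ConcreteCategory.congr_hom (F.obj.map_add (f := f) (g := g)) x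

@[simp]
lemma act_zero {A B : C} (x : ev F A) : act F (0 : A ⟶ B) x = 0 := by
  have h := act_add (0 : A ⟶ B) 0 x
  rw [add_zero] at h
  exact left_eq_add.1 h

lemma nat_ext {α β : F ⟶ G} (h : ∀ A x, app α A x = app β A x) : α = β := by
  apply ObjectProperty.hom_ext
  ext A x
  exact h A x

/-- A natural transformation with bijective components is an isomorphism. -/
def isoOfBijective (α : F ⟶ G) (h : ∀ A, Function.Bijective (app α A)) : F ≅ G where
  hom := α
  inv := mkNat (fun A => (AddEquiv.ofBijective (app α A) (h A)).symm.toAddMonoidHom)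
    (fun {A B} f x => by
      obtain ⟨y, rfl⟩ := (h A).2 x
      change (AddEquiv.ofBijective (app α B) (h B)).symm _ =
        act F f ((AddEquiv.ofBijective (app α A) (h A)).symm _)
      rw [← app_act]
      exact ((AddEquiv.ofBijective (app α B) (h B)).symm_apply_apply _).trans (congrArg (act F f)
        ((AddEquiv.ofBijective (app α A) (h A)).symm_apply_apply y).symm))
  hom_inv_id := nat_ext fun A x => (AddEquiv.ofBijective (app α A) (h A)).symm_apply_apply x
  inv_hom_id := nat_ext fun A x => (AddEquiv.ofBijective (app α A) (h A)).apply_symm_apply x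

lemma isIso_of_bijective (α : F ⟶ G) (h : ∀ A, Function.Bijective (app α A)) : IsIso α :=
  (isoOfBijective α h).isIso_hom

lemma bijective_of_isIso (α : F ⟶ G) [IsIso α] (A : C) : Function.Bijective (app α A) := by
  refine Function.bijective_iff_has_inverse.2 ⟨app (inv α) A, fun x => ?_, fun x => ?_⟩
  · rw [← app_comp, IsIso.hom_inv_id, app_id]
  · rw [← app_comp, IsIso.inv_hom_id, app_id]

/-- A morphism `A ⟶ B` as an element of `(A, -)` at `B`. -/
def el {A B : C} (h : A ⟶ B) : ev (rep A) B := h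

lemma exists_el {A B : C} (x : ev (rep A) B) : ∃ h : A ⟶ B, el h = x := ⟨x, rfl⟩

lemma act_el {A B D : C} (h : A ⟶ B) (f : B ⟶ D) : act (rep A) f (el h) = el (h ≫ f) := rfl

/-- The map `(A, -) ⟶ F` sending the identity to `x`. -/
def yo {A : C} (x : ev F A) : rep A ⟶ F :=
  mkNat (fun B =>
    { toFun := fun h : A ⟶ B => act F h x
      map_zero' := act_zero x
      map_add' := fun f g => act_add f g x })
    (fun f (h : A ⟶ _) => act_comp h f x)

@[simp]
lemma app_yo {A B : C} (x : ev F A) (h : A ⟶ B) :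
    app (yo x) B (el h) = act F h x := rfl

lemma app_rep {A : C} (α : rep A ⟶ F) {B : C} (h : A ⟶ B) :
    app α B (el h) = act F h (app α A (el (𝟙 A))) := by
  rw [← app_act, act_el, Category.id_comp]

lemma rep_ext {A : C} {α β : rep A ⟶ F}
    (h : app α A (el (𝟙 A)) = app β A (el (𝟙 A))) : α = β :=
  nat_ext fun _ x => (app_rep α x).trans ((congrArg _ h).trans (app_rep β x).symm)

lemma yo_comp {A : C} (x : ev F A) (α : F ⟶ G) : yo x ≫ α = yo (app α A x) :=
  nat_ext fun _ h => app_act α h x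

/-- A sequence which is exact at the middle. -/
def ExactSeq (i : F ⟶ G) (q : G ⟶ H) : Prop := ∀ A, Function.Exact (app i A) (app q A)

lemma ExactSeq.comp_eq_zero {i : F ⟶ G} {q : G ⟶ H} (h : ExactSeq i q) : i ≫ q = 0 :=
  nat_ext fun A x => (h A).apply_apply_eq_zero x

/-- Descent along a cokernel. -/
lemma exists_desc {i : F ⟶ G} {q : G ⟶ H} (h : RightExactSeq i q) (β : G ⟶ K)
    (hβ : i ≫ β = 0) : ∃ γ : H ⟶ K, q ≫ γ = β := by
  have hker : ∀ A, (app q A).ker ≤ (app β A).ker := by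
    intro A x hx
    obtain ⟨y, rfl⟩ := ((h A).1 x).1 hx
    change app β A (app i A y) = 0
    rw [← app_comp, hβ, app_zero]
  let a : ∀ A, ev H A →+ ev K A := fun A =>
    AddMonoidHom.liftOfRightInverse (app q A)
      (Function.surjInv (h A).2) (Function.rightInverse_surjInv (h A).2) ⟨app β A, hker A⟩
  have ha : ∀ A x, a A (app q A x) = app β A x := fun A x =>
    AddMonoidHom.liftOfRightInverse_comp_apply _ _ _ _ x
  refine ⟨mkNat a fun {A B} f x => ?_, nat_ext ha⟩
  obtain ⟨y, rfl⟩ := (h A).2 x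
  change a B (act H f (app q A y)) = act K f (a A (app q A y))
  rw [ha, ← app_act, ha, app_act]

lemma surj_ext {q : G ⟶ H} (h : ∀ A, Function.Surjective (app q A)) {α β : H ⟶ K}
    (e : q ≫ α = q ≫ β) : α = β :=
  nat_ext fun A x => by
    obtain ⟨y, rfl⟩ := h A x
    rw [← app_comp, e, app_comp]

/-- Two cokernels of the same map are isomorphic. -/
lemma RightExactSeq.exists_iso {i : F ⟶ G} {q : G ⟶ H} {q' : G ⟶ K} (h : RightExactSeq i q)
    (h' : RightExactSeq i q') : ∃ e : H ≅ K, q ≫ e.hom = q' := by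
  obtain ⟨a, ha⟩ := exists_desc h q' (nat_ext fun A x => (h' A).1.apply_apply_eq_zero x)
  obtain ⟨b, hb⟩ := exists_desc h' q (nat_ext fun A x => (h A).1.apply_apply_eq_zero x)
  refine ⟨⟨a, b, surj_ext (fun A => (h A).2) ?_, surj_ext (fun A => (h' A).2) ?_⟩, ha⟩
  · rw [← Category.assoc, ha, hb, Category.comp_id]
  · rw [← Category.assoc, hb, ha, Category.comp_id]

/-- The kernel of a natural transformation. -/
def kerFun (φ : F ⟶ G) : AddFun C where
  obj :=
    { obj A := AddCommGrpCat.of (app φ A).ker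
      map {A B} f := AddCommGrpCat.ofHom
        (((act F f).comp (app φ A).ker.subtype).codRestrict (app φ B).ker fun x => by
          change app φ B (act F f x.1) = 0
          rw [app_act, show app φ A x.1 = 0 from x.2, map_zero])
      map_id A := by
        ext x
        exact act_id A x.1
      map_comp f g := by
        ext x
        exact act_comp f g x.1 }
  property :=
    { map_add {A B f g} := by
        ext x
        exact act_add f g x.1 }

/-- The inclusion of the kernel. -/
def kerIncl (φ : F ⟶ G) : kerFun φ ⟶ F :=
  mkNat (fun A => (app φ A).ker.subtype) (fun _ _ => rfl)

lemma kerIncl_injective (φ : F ⟶ G) (A : C) : Function.Injective (app (kerIncl φ) A) :=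
  Subtype.val_injective

lemma exactSeq_kerIncl (φ : F ⟶ G) : ExactSeq (kerIncl φ) φ := by
  intro A x
  constructor
  · intro h
    exact ⟨⟨x, h⟩, rfl⟩
  · rintro ⟨y, rfl⟩
    exact y.2

/-- Lifting through a kernel. -/
lemma exists_lift {i : F ⟶ G} {q : G ⟶ H} (hi : ∀ A, Function.Injective (app i A))
    (h : ExactSeq i q) (β : K ⟶ G) (hβ : β ≫ q = 0) : ∃ γ : K ⟶ F, γ ≫ i = β := by
  have key : ∀ A (x : ev K A), ∃ y, app i A y = app β A x := fun A x =>
    (h A _).1 (by rw [← app_comp, hβ, app_zero])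
  choose γ hγ using key
  refine ⟨mkNat (fun A => AddMonoidHom.mk' (γ A) fun x y => hi A ?_)
    fun {A B} f x => hi B ?_, nat_ext hγ⟩
  · rw [map_add, hγ, hγ, hγ, map_add]
  · change app i B (γ B (act K f x)) = app i B (act F f (γ A x))
    rw [hγ, app_act, app_act, hγ]

/-- The cokernel of a natural transformation. -/
def cokFun (φ : F ⟶ G) : AddFun C where
  obj :=
    { obj A := AddCommGrpCat.of (ev G A ⧸ (app φ A).range)
      map {A B} f := AddCommGrpCat.ofHom
        (QuotientAddGroup.map _ _ (act G f) (by
          rintro _ ⟨x, rfl⟩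
          exact ⟨act F f x, app_act φ f x⟩))
      map_id A := by
        apply AddCommGrpCat.hom_ext
        apply QuotientAddGroup.addMonoidHom_ext
        ext x
        exact congrArg QuotientAddGroup.mk (act_id A x)
      map_comp f g := by
        apply AddCommGrpCat.hom_ext
        apply QuotientAddGroup.addMonoidHom_ext
        ext x
        exact congrArg QuotientAddGroup.mk (act_comp f g x) }
  property :=
    { map_add {A B f g} := by
        apply AddCommGrpCat.hom_ext
        apply QuotientAddGroup.addMonoidHom_ext
        ext x
        exact congrArg QuotientAddGroup.mk (act_add f g x) }

/-- The projection to the cokernel. -/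
def cokProj (φ : F ⟶ G) : G ⟶ cokFun φ :=
  mkNat (fun _ => QuotientAddGroup.mk' _) (fun _ _ => rfl)

lemma rightExactSeq_cokProj (φ : F ⟶ G) : RightExactSeq φ (cokProj φ) := by
  intro A
  exact ⟨fun x => QuotientAddGroup.eq_zero_iff x, QuotientAddGroup.mk'_surjective _⟩

end Elements

/-! ### Functors presented by a class of objects -/

section RelFP

variable {C : Type w} [Category.{v} C] [Preadditive C]

/-- `F` has a presentation by functors represented by objects with the property `Q`. -/
def relFP (Q : ObjectProperty C) : ObjectProperty (AddFun C) := fun F =>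
  ∃ (X Y : C) (_ : Q X) (_ : Q Y) (g : rep Y ⟶ rep X) (p : rep X ⟶ F), RightExactSeq g p

lemma isFPFun_of_relFP {Q : ObjectProperty C} {F : AddFun C} : relFP Q F → isFPFun C F :=
  fun ⟨X, Y, _, _, g, p, h⟩ => ⟨X, Y, g, p, h⟩

lemma relFP_top_of_isFPFun {F : AddFun C} : isFPFun C F → relFP ⊤ F :=
  fun ⟨X, Y, g, p, h⟩ => ⟨X, Y, trivial, trivial, g, p, h⟩

/-- The map of objects inducing a map of representable functors. -/
def repMap {X Y : C} (g : rep Y ⟶ rep X) : X ⟶ Y := app g Y (el (𝟙 Y))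

lemma app_repMap {X Y A : C} (g : rep Y ⟶ rep X) (h : Y ⟶ A) :
    app g A (el h) = (el (repMap g ≫ h)) :=
  app_rep g h

lemma RightExactSeq.app_eq_zero_iff {X Y A : C} {F : AddFun C} {g : rep Y ⟶ rep X}
    {p : rep X ⟶ F} (h : RightExactSeq g p) (a : X ⟶ A) :
    app p A (el a) = 0 ↔ ∃ b : Y ⟶ A, repMap g ≫ b = a := by
  refine ((h A).1 _).trans ⟨?_, ?_⟩
  · rintro ⟨b, hb⟩
    exact ⟨b, (app_repMap g b).symm.trans hb⟩
  · rintro ⟨b, hb⟩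
    exact ⟨b, (app_repMap g b).trans hb⟩

lemma RightExactSeq.exists_app_eq {X Y A : C} {F : AddFun C} {g : rep Y ⟶ rep X}
    {p : rep X ⟶ F} (h : RightExactSeq g p) (x : ev F A) :
    ∃ a : X ⟶ A, app p A (el a) = x := (h A).2 x

lemma relFP_of_iso {Q : ObjectProperty C} {F F' : AddFun C} (e : F ≅ F') (hF : relFP Q F) :
    relFP Q F' := by
  obtain ⟨X, Y, hX, hY, g, p, h⟩ := hF
  refine ⟨X, Y, hX, hY, g, p ≫ e.hom, fun A => ⟨fun x => ?_, fun x => ?_⟩⟩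
  · refine Iff.trans ?_ ((h A).1 x)
    exact map_eq_zero_iff (app e.hom A) (bijective_of_isIso e.hom A).1
  · obtain ⟨y, rfl⟩ := (bijective_of_isIso e.hom A).2 x
    obtain ⟨z, rfl⟩ := (h A).2 y
    exact ⟨z, rfl⟩

lemma relFP_of_rightExactSeq {Q : ObjectProperty C} {F₁ F₀ F : AddFun C} {X Y : C} (hX : Q X)
    (hY : Q Y) (e₁ : rep Y ≅ F₁) (e₀ : rep X ≅ F₀) {g : F₁ ⟶ F₀} {p : F₀ ⟶ F}
    (h : RightExactSeq g p) : relFP Q F := by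
  refine ⟨X, Y, hX, hY, e₁.hom ≫ g ≫ e₀.inv, e₀.hom ≫ p, fun A => ⟨fun x => ?_, fun x => ?_⟩⟩
  · refine ((h A).1 (app e₀.hom A x)).trans ⟨?_, ?_⟩
    · rintro ⟨y, hy⟩
      obtain ⟨z, rfl⟩ := (bijective_of_isIso e₁.hom A).2 y
      refine ⟨z, ?_⟩
      change app e₀.inv A (app g A (app e₁.hom A z)) = x
      refine (congrArg (app e₀.inv A) hy).trans ?_
      rw [← app_comp, e₀.hom_inv_id, app_id]
    · rintro ⟨z, rfl⟩
      refine ⟨app e₁.hom A z, ?_⟩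
      change app g A _ = app e₀.hom A (app e₀.inv A (app g A (app e₁.hom A z)))
      rw [← app_comp e₀.inv, e₀.inv_hom_id, app_id]
  · obtain ⟨y, rfl⟩ := (h A).2 x
    obtain ⟨z, rfl⟩ := (bijective_of_isIso e₀.hom A).2 y
    exact ⟨z, rfl⟩

/-- Weak pushouts exist among the objects with the property `Q`. -/
def HasWeakPushouts (Q : ObjectProperty C) : Prop :=
  ∀ ⦃X' X Y' : C⦄, Q X' → Q X → Q Y' → ∀ (h : X' ⟶ X) (f : X' ⟶ Y'),
    ∃ (P : C) (_ : Q P) (a : X ⟶ P) (b : Y' ⟶ P), h ≫ a = f ≫ b ∧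
      ∀ ⦃A : C⦄ (s : X ⟶ A) (t : Y' ⟶ A), h ≫ s = f ≫ t → ∃ c : P ⟶ A, a ≫ c = s

/-- The kernel of a map from a representable functor to a finitely presented one is finitely
generated. -/
lemma exists_ker_generator {Q : ObjectProperty C} (hQ : HasWeakPushouts Q) {X : C} (hX : Q X)
    {F : AddFun C} (hF : relFP Q F) (φ : rep X ⟶ F) :
    ∃ (P : C) (_ : Q P) (a : X ⟶ P), ∀ {A} (s : X ⟶ A),
      app φ A (el s) = 0 ↔ ∃ c : P ⟶ A, a ≫ c = s := by
  obtain ⟨X', Y', hX', hY', g, p, hp⟩ := hF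
  -- Projectivity of `(X, -)`: `φ` lifts through `p` to precomposition with some `h : X' ⟶ X`.
  obtain ⟨h, hh⟩ := hp.exists_app_eq (app φ X (el (𝟙 X)))
  have key : ∀ {A} (s : X ⟶ A), app φ A (el s) =
      app p A (el (h ≫ s)) := by
    intro A s
    rw [app_rep φ s, ← hh, ← app_act]
    rfl
  -- `φ` kills `s` exactly when `h ≫ s` factors through `repMap g`, that is, when `s` extends to a
  -- cocone on the span of `h` and `repMap g`.
  obtain ⟨P, hP, a, b, hab, hu⟩ := hQ hX' hX hY' h (repMap g)
  refine ⟨P, hP, a, fun {A} s => ?_⟩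
  rw [key, hp.app_eq_zero_iff]
  constructor
  · rintro ⟨t, ht⟩
    exact hu s t ht.symm
  · rintro ⟨c, rfl⟩
    exact ⟨b ≫ c, by rw [← Category.assoc, ← hab, Category.assoc]⟩

/-- Functors with a presentation by objects in `Q` are closed under kernels. -/
lemma relFP_of_ker {Q : ObjectProperty C} (hQ : HasWeakPushouts Q) {K F F' : AddFun C}
    (hF : relFP Q F) (hF' : relFP Q F') {i : K ⟶ F} {φ : F ⟶ F'}
    (hi : ∀ A, Function.Injective (app i A)) (h : ExactSeq i φ) : relFP Q K := by
  obtain ⟨X, Y, hX, hY, g, p, hp⟩ := id hF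
  -- Since `a` generates the kernel of `p ≫ φ`, its image under `p` comes from an element `x` of `K`
  -- at `P`, and this `x` generates `K`.
  obtain ⟨P, hP, a, ha⟩ := exists_ker_generator hQ hX hF' (p ≫ φ)
  obtain ⟨x, hx⟩ := (h P (app p P (el a))).1
    ((ha a).2 ⟨𝟙 P, Category.comp_id a⟩)
  -- As `i` is injective, the relations on `x` form the kernel of `(P, -) ⟶ F`, which is finitely
  -- generated because `F` is finitely presented as well.
  obtain ⟨P', hP', b, hb⟩ := exists_ker_generator hQ hP hF (yo x ≫ i)
  refine ⟨P, P', hP, hP', yo (el b), yo x, fun A => ⟨fun s => ?_, fun y => ?_⟩⟩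
  · refine Iff.trans ?_ (hb s)
    exact (map_eq_zero_iff (app i A) (hi A)).symm
  · obtain ⟨s, hs⟩ := hp.exists_app_eq (app i A y)
    obtain ⟨c, rfl⟩ := (ha s).1 (by
      rw [app_comp, hs, ← app_comp, h.comp_eq_zero, app_zero])
    refine ⟨c, hi A ?_⟩
    change app i A (act K c x) = _
    rw [app_act, hx, ← app_act, ← hs]
    rfl

end RelFP

/-! ### Extension of natural transformations -/

section Extension

variable {C : Type w} [Category.{v} C] [Preadditive C]

/-- `H` is exact at the middle of sequences `X ⟶ Y ⟶ Z`, for a suitable `Y ⟶ Z` depending on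
`X ⟶ Y`. -/
def WeakCokernelExact (H : AddFun C) : Prop :=
  ∀ ⦃X Y : C⦄ (f : X ⟶ Y), ∃ (Z : C) (c : Y ⟶ Z), f ≫ c = 0 ∧
    ∀ y : ev H Y, act H c y = 0 → ∃ x, act H f x = y

/-- Natural transformations to a functor which is exact on cokernel sequences extend along
monomorphisms with finitely presented cokernel. -/
lemma exists_extension {A B Q H : AddFun C} (hH : WeakCokernelExact H) {i : A ⟶ B} {q : B ⟶ Q}
    (hi : ∀ W, Function.Injective (app i W)) (hiq : RightExactSeq i q) (hQ : isFPFun C Q)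
    (α : A ⟶ H) : ∃ β : B ⟶ H, i ≫ β = α := by
  obtain ⟨X, Y, g, p, hp⟩ := hQ
  -- `b` lifts the generator of `Q` to `B`; together with `A` it generates `B`.
  obtain ⟨b, hb⟩ := (hiq X).2 (app p X (el (𝟙 X)))
  have hqb : ∀ {W} (h : X ⟶ W), app q W (act B h b) = app p W (el h) := by
    intro W h
    rw [app_act, app_rep p h]
    exact congrArg _ hb
  have hzero : ∀ {W} (h : X ⟶ W), app q W (act B h b) = 0 ↔ ∃ k, repMap g ≫ k = h :=
    fun h => by rw [hqb, hp.app_eq_zero_iff]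
  -- The defining relation of `Q` need not hold for `b`; its defect is an element `a` of `A`.
  obtain ⟨a, ha⟩ := ((hiq Y).1 (act B (repMap g) b)).1
    ((hzero _).2 ⟨𝟙 Y, Category.comp_id _⟩)
  change app i Y a = _ at ha
  -- The extension must send `b` to some `d` with `repMap g` acting on `d` as `α a`. Such a `d`
  -- exists by exactness of `H`, because `c` already kills `a`.
  obtain ⟨Z, c, hc, hex⟩ := hH (repMap g)
  have haz : act A c a = 0 := by
    apply hi
    rw [app_act, ha, ← act_comp, hc, act_zero, map_zero]
  obtain ⟨d, hd⟩ := hex (app α Y a) (by rw [← app_act, haz, map_zero])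
  -- `B` is the quotient of `A ⊕ (X, -)` by the map `φ`, so it remains to see that `ψ` vanishes on
  -- the kernel of `φ`.
  let φ : ∀ W, ev A W × (X ⟶ W) →+ ev B W := fun W =>
    { toFun := fun z => app i W z.1 + act B z.2 b
      map_zero' := by simp
      map_add' := fun z z' => by
        simp only [Prod.fst_add, Prod.snd_add, map_add, act_add]
        abel }
  let ψ : ∀ W, ev A W × (X ⟶ W) →+ ev H W := fun W =>
    { toFun := fun z => app α W z.1 + act H z.2 d
      map_zero' := by simp
      map_add' := fun z z' => by
        simp only [Prod.fst_add, Prod.snd_add, map_add, act_add]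
        abel }
  have hφ : ∀ W, Function.Surjective (φ W) := by
    intro W y
    obtain ⟨h, hh⟩ := hp.exists_app_eq (app q W y)
    have h0 : app q W (y - act B h b) = 0 := by
      rw [map_sub, hqb, hh, sub_self]
    obtain ⟨x, hx⟩ := ((hiq W).1 _).1 h0
    exact ⟨(x, h), (congrArg (· + act B h b) hx).trans (sub_add_cancel _ _)⟩
  have hker : ∀ W, (φ W).ker ≤ (ψ W).ker := by
    rintro W ⟨x, h⟩ hz
    have hz' : app i W x + act B h b = 0 := hz
    have h0 : app q W (act B h b) = 0 := by
      have h1 := congrArg (app q W) hz'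
      rw [map_add, map_zero] at h1
      rwa [show app q W (app i W x) = 0 from (hiq W).1.apply_apply_eq_zero x, zero_add] at h1
    -- Kernel elements are exactly the translates of the one relation: `h` factors as `repMap g ≫
    -- k`, and `x` is minus the action of `k` on `a`.
    obtain ⟨k, rfl⟩ := (hzero h).1 h0
    have hx : x + act A k a = 0 := by
      apply hi
      rw [map_add, app_act, ha, ← act_comp, map_zero, hz']
    change app α W x + act H (repMap g ≫ k) d = 0
    rw [act_comp, hd, ← app_act, ← map_add, hx, map_zero]
  let β : ∀ W, ev B W →+ ev H W := fun W =>
    AddMonoidHom.liftOfRightInverse (φ W)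
      (Function.surjInv (hφ W)) (Function.rightInverse_surjInv (hφ W)) ⟨ψ W, hker W⟩
  have hβ : ∀ W z, β W (φ W z) = ψ W z := fun W z =>
    AddMonoidHom.liftOfRightInverse_comp_apply _ _ _ _ z
  refine ⟨mkNat β fun {W W'} f y => ?_, nat_ext fun W x => ?_⟩
  · obtain ⟨⟨x, h⟩, rfl⟩ := hφ W y
    rw [hβ]
    have h1 : act B f (φ W (x, h)) = φ W' (act A f x, h ≫ f) := by
      change act B f (app i W x + act B h b) = app i W' (act A f x) + act B (h ≫ f) b
      rw [map_add, app_act, act_comp]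
    rw [h1, hβ]
    change app α W' (act A f x) + act H (h ≫ f) d = act H f (app α W x + act H h d)
    rw [map_add, app_act, act_comp]
  · have h1 : app i W x = φ W (x, 0) := by
      change _ = app i W x + act B 0 b
      rw [act_zero, add_zero]
    change β W (app i W x) = app α W x
    rw [h1, hβ]
    change app α W x + act H 0 d = _
    rw [act_zero, add_zero]

end Extension

/-! ### Elements of `k ↦ Nat(G, T k)` -/

section Pairings

variable {J : Type w} [Category.{u} J] [Preadditive J] [EssentiallySmall.{u} J]
variable {K : Type v} [Category.{u} K] [Preadditive K] {T : K ⥤ AddFun J} [T.Additive]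

/-- The natural transformation `G ⟶ T k` given by an element of `Nat(G, T -)` at `k`. -/
def ndHom {G : AddFun J} {k : K} : ev (natDualObj T G) k ≃+ (G ⟶ T.obj k) :=
  (natGrpEquiv G (T.obj k)).symm

/-- With `ndHom_natDual_map`, this allows computing with transformations `G ⟶ T k` and forgetting
the passage to a smaller universe in `natGrp`. -/
lemma ndHom_act {G : AddFun J} {k l : K} (f : k ⟶ l) (z : ev (natDualObj T G) k) :
    ndHom (act (natDualObj T G) f z) = ndHom z ≫ T.map f := by
  obtain ⟨φ, rfl⟩ := (natGrpEquiv G (T.obj k)).surjective z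
  refine (congrArg (natGrpEquiv G (T.obj l)).symm (natGrpMap_apply (𝟙 G) (T.map f) φ)).trans ?_
  rw [AddEquiv.symm_apply_apply, Category.id_comp]
  exact congrArg (· ≫ T.map f) ((natGrpEquiv G (T.obj k)).symm_apply_apply φ).symm

lemma ndHom_natDual_map {G G' : AddFun J} (a : G' ⟶ G) {k : K} (z : ev (natDualObj T G) k) :
    ndHom (T := T) (app ((natDual T).map a.op) k z) = a ≫ ndHom z := by
  obtain ⟨φ, rfl⟩ := (natGrpEquiv G (T.obj k)).surjective z
  refine (congrArg (natGrpEquiv G' (T.obj k)).symm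
    (natGrpMap_apply a (𝟙 (T.obj k)) φ)).trans ?_
  rw [AddEquiv.symm_apply_apply, Category.comp_id]
  exact congrArg (a ≫ ·) ((natGrpEquiv G (T.obj k)).symm_apply_apply φ).symm

/-- The pairing `F k → Nat(G, T k)` given by a map `F ⟶ Nat(G, T -)`. -/
def pair {F : AddFun K} {G : AddFun J} (α : F ⟶ natDualObj T G) (k : K) :
    ev F k →+ (G ⟶ T.obj k) :=
  ndHom.toAddMonoidHom.comp (app α k)

lemma pair_apply {F : AddFun K} {G : AddFun J} (α : F ⟶ natDualObj T G) (k : K) (x : ev F k) :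
    pair α k x = ndHom (app α k x) := rfl

lemma pair_act {F : AddFun K} {G : AddFun J} (α : F ⟶ natDualObj T G) {k l : K} (f : k ⟶ l)
    (x : ev F k) : pair α l (act F f x) = pair α k x ≫ T.map f := by
  rw [pair_apply, app_act, ndHom_act, pair_apply]

/-- The map `F ⟶ Nat(G, T -)` given by a pairing. -/
def unpair {F : AddFun K} {G : AddFun J} (c : ∀ k, ev F k →+ (G ⟶ T.obj k))
    (h : ∀ {k l} (f : k ⟶ l) x, c l (act F f x) = c k x ≫ T.map f) : F ⟶ natDualObj T G :=
  mkNat (fun k => ndHom.symm.toAddMonoidHom.comp (c k)) fun {k l} f x => ndHom.injective (by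
    rw [ndHom_act]
    change ndHom (ndHom.symm (c l (act F f x))) = ndHom (ndHom.symm (c k x)) ≫ _
    rw [AddEquiv.apply_symm_apply, AddEquiv.apply_symm_apply, h])

@[simp]
lemma pair_unpair {F : AddFun K} {G : AddFun J} (c : ∀ k, ev F k →+ (G ⟶ T.obj k))
    (h : ∀ {k l} (f : k ⟶ l) x, c l (act F f x) = c k x ≫ T.map f) (k : K) (x : ev F k) :
    pair (unpair c h) k x = c k x :=
  AddEquiv.apply_symm_apply ndHom (c k x)

/-- A map into a dual is a pairing of elements; identities between maps into duals are reduced to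
values of pairings through this lemma. -/
lemma pair_ext {F : AddFun K} {G : AddFun J} {α β : F ⟶ natDualObj T G}
    (h : ∀ k x j y, app (pair α k x) j y = app (pair β k x) j y) : α = β :=
  nat_ext fun k x => ndHom.injective (nat_ext fun j y => h k x j y)

/-- The biduality criterion: a pairing between `F = coker ((f, -))` and a functor isomorphic to
`ker (T f)` identifies `F` with `k ↦ Nat(ker (T f), T k)`. -/
theorem bijective_of_pairing [T.Full] [T.Faithful] (hJ : HasWeakPushouts (⊤ : ObjectProperty J))
    (hT : ∀ k, WeakCokernelExact (T.obj k)) {F : AddFun K} {E : AddFun J}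
    (α : F ⟶ natDualObj T E) {X Y : K} {g : rep Y ⟶ rep X} {p : rep X ⟶ F}
    (hp : RightExactSeq g p)
    (hinj : ∀ j, Function.Injective (app (pair α X (app p X (el (𝟙 X)))) j))
    (hexact : ExactSeq (pair α X (app p X (el (𝟙 X)))) (T.map (repMap g)))
    (hY : isFPFun J (T.obj Y)) {Q : AddFun J} (hQ : isFPFun J Q) {c : T.obj Y ⟶ Q}
    (hc : RightExactSeq (T.map (repMap g)) c) (k : K) : Function.Bijective (app α k) := by
  set u := pair α X (app p X (el (𝟙 X))) with hu
  -- The image of `T.map (repMap g)` is the kernel of its cokernel `c`, and in this form it is seen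
  -- to be finitely presented.
  have hI : isFPFun J (kerFun c) := isFPFun_of_relFP (relFP_of_ker hJ
    (relFP_top_of_isFPFun hY) (relFP_top_of_isFPFun hQ) (kerIncl_injective c)
    (exactSeq_kerIncl c))
  obtain ⟨e, he⟩ := exists_lift (kerIncl_injective c) (exactSeq_kerIncl c) (T.map (repMap g))
    (nat_ext fun A x => (hc A).1.apply_apply_eq_zero x)
  -- The four-term sequence splits into `E ⟶ T X ⟶ I` and `I ⟶ T Y ⟶ Q`, with `I = kerFun c`; both
  -- cokernels are finitely presented, so maps to `T k` extend along both monomorphisms.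
  have hue : RightExactSeq u e := by
    intro A
    refine ⟨fun x => ?_, fun y => ?_⟩
    · refine Iff.trans ?_ (hexact A x)
      rw [← he]
      exact (map_eq_zero_iff _ (kerIncl_injective c A)).symm
    · obtain ⟨x, hx⟩ := ((hc A).1 (app (kerIncl c) A y)).1 y.2
      refine ⟨x, kerIncl_injective c A ?_⟩
      rw [← hx]
      exact congrArg (fun γ => app γ A x) he
  have hιc : RightExactSeq (kerIncl c) c := fun A => ⟨exactSeq_kerIncl c A, (hc A).2⟩
  have hval : ∀ a : X ⟶ k, pair α k (app p k (el a)) = u ≫ T.map a := by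
    intro a
    rw [app_rep, pair_act]
  have hsuff : Function.Bijective (pair α k) := by
    constructor
    -- If `T a` vanishes on `E`, it factors through `I`, and the factor extends to `T Y`. Fullness
    -- makes the extension a morphism `b`, and faithfulness gives `repMap g ≫ b = a`.
    · refine (injective_iff_map_eq_zero _).2 fun x hx => ?_
      obtain ⟨a, rfl⟩ := hp.exists_app_eq x
      rw [hval] at hx
      obtain ⟨γ, hγ⟩ := exists_desc hue _ hx
      obtain ⟨δ, hδ⟩ := exists_extension (hT k) (kerIncl_injective c) hιc hQ γ
      obtain ⟨b, rfl⟩ := T.map_surjective δ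
      rw [hp.app_eq_zero_iff]
      refine ⟨b, T.map_injective ?_⟩
      rw [T.map_comp, ← he, Category.assoc, hδ, hγ]
    -- Extending `ν` from `E` to `T X` and using fullness represents it by some `a : X ⟶ k`.
    · intro ν
      obtain ⟨δ, hδ⟩ := exists_extension (hT k) hinj hue hI ν
      obtain ⟨a, rfl⟩ := T.map_surjective δ
      exact ⟨app p k (el a), (hval a).trans hδ⟩
  exact (EquivLike.comp_bijective (app α k) ndHom).1 hsuff

end Pairings

/-! ### Exactness of the tensor product -/

section TensorExact

variable {R : Type u} [Ring R]

lemma op_smul_tmul {X : RMod R} {L : ModuleCat.{u} R} (r : R) (x : X) (l : L) :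
    tmul (MulOpposite.op r • x) l = tmul x (r • l) := by
  refine QuotientAddGroup.eq_iff_sub_mem.2 (AddSubgroup.subset_closure ⟨x, r, l, rfl⟩)

/-- The pure tensors as a biadditive map. -/
def tmulHom (X : RMod R) (L : ModuleCat.{u} R) : X →+ L →+ tensor X L :=
  AddMonoidHom.mk' (fun x => AddMonoidHom.mk' (fun l => tmul x l) (tmul_add x))
    fun x x' => AddMonoidHom.ext fun l => add_tmul x x' l

lemma tensor_induction {X : RMod R} {L : ModuleCat.{u} R} {P : tensor X L → Prop}
    (h : ∀ x l, P (tmul x l)) (h0 : P 0) (hadd : ∀ s t, P s → P t → P (s + t))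
    (t : tensor X L) : P t := by
  obtain ⟨t, rfl⟩ := QuotientAddGroup.mk_surjective t
  induction t using TensorProduct.induction_on with
  | zero => exact h0
  | tmul x l => exact h x l
  | add a b ha hb => exact hadd _ _ ha hb

/-- The universal property of the tensor product. -/
def tensorLift {X : RMod R} {L : ModuleCat.{u} R} {A : Type u} [AddCommGroup A]
    (b : X →+ L →+ A) (h : ∀ x (r : R) l, b (MulOpposite.op r • x) l = b x (r • l)) :
    tensor X L →+ A :=
  QuotientAddGroup.lift (balanced (R := R) X L)
    (TensorProduct.liftAddHom b fun n x l => by rw [map_zsmul, map_zsmul]; rfl) (by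
      rw [balanced, AddSubgroup.closure_le]
      rintro _ ⟨x, r, l, rfl⟩
      change TensorProduct.liftAddHom b _ _ = 0
      rw [map_sub]
      exact sub_eq_zero.2 (h x r l))

lemma tensorMap_left_surjective {X Y : RMod R} {q : X ⟶ Y} (hq : Function.Surjective q)
    (L : ModuleCat.{u} R) : Function.Surjective (tensorMap q (𝟙 L)) := by
  intro t
  induction t using tensor_induction with
  | h y l =>
    obtain ⟨x, rfl⟩ := hq y
    exact ⟨tmul x l, rfl⟩
  | h0 => exact ⟨0, map_zero _⟩
  | hadd s t hs ht =>
    obtain ⟨s, rfl⟩ := hs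
    obtain ⟨t, rfl⟩ := ht
    exact ⟨s + t, map_add _ _ _⟩

lemma tensorMap_right_surjective (X : RMod R) {L M : ModuleCat.{u} R} {q : L ⟶ M}
    (hq : Function.Surjective q) : Function.Surjective (tensorMap (𝟙 X) q) := by
  intro t
  induction t using tensor_induction with
  | h x y =>
    obtain ⟨l, rfl⟩ := hq y
    exact ⟨tmul x l, rfl⟩
  | h0 => exact ⟨0, map_zero _⟩
  | hadd s t hs ht =>
    obtain ⟨s, rfl⟩ := hs
    obtain ⟨t, rfl⟩ := ht
    exact ⟨s + t, map_add _ _ _⟩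

/-- The projection of `Y ⊗ L` onto the cokernel of `f ⊗ L` factors through `q ⊗ L`, so anything
killed by `q ⊗ L` lies in the image of `f ⊗ L`. -/
lemma tensorMap_left_exact {X Y Z : RMod R} {f : X ⟶ Y} {q : Y ⟶ Z} (h : Function.Exact f q)
    (hq : Function.Surjective q) (L : ModuleCat.{u} R) :
    Function.Exact (tensorMap f (𝟙 L)) (tensorMap q (𝟙 L)) := by
  let N : AddSubgroup (tensor Y L) := (tensorMap f (𝟙 L)).hom.range
  let π : tensor Y L →+ tensor Y L ⧸ N := QuotientAddGroup.mk' N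
  have key : ∀ y y' l, q y = q y' → π (tmul y l) = π (tmul y' l) := by
    intro y y' l e
    obtain ⟨x, hx⟩ := (h (y - y')).1 (by rw [map_sub, e, sub_self])
    rw [← sub_eq_zero, ← map_sub]
    refine (QuotientAddGroup.eq_zero_iff _).2 ⟨tmul x l, ?_⟩
    change tmul (f x) l = _
    rw [hx]
    exact congrArg (fun k => k l) (map_sub (tmulHom Y L) y y')
  -- `σ` is only a section of sets; by `key` the class of `σ z ⊗ l` depends on `z` alone, which
  -- makes the assignment additive and balanced.
  obtain ⟨σ, hσ⟩ := hq.hasRightInverse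
  let s : tensor Z L →+ tensor Y L ⧸ N := tensorLift
    (AddMonoidHom.mk' (fun z => π.comp (tmulHom Y L (σ z))) fun z z' => AddMonoidHom.ext fun l => by
      change π (tmul _ l) = π (tmul _ l) + π (tmul _ l)
      rw [← map_add, ← add_tmul]
      apply key
      rw [map_add, hσ, hσ, hσ])
    fun z r l => by
      change π (tmul _ _) = π (tmul _ _)
      rw [← op_smul_tmul]
      apply key
      rw [map_smul, hσ, hσ]
  have hs : ∀ t, s (tensorMap q (𝟙 L) t) = π t := by
    intro t
    induction t using tensor_induction with
    | h y l => exact key _ _ _ (hσ _)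
    | h0 => simp only [map_zero]
    | hadd a b ha hb => rw [map_add, map_add, map_add, ha, hb]
  intro t
  constructor
  · intro ht
    exact (QuotientAddGroup.eq_zero_iff t).1 ((hs t).symm.trans (by rw [ht, map_zero]))
  · rintro ⟨t, rfl⟩
    induction t using tensor_induction with
    | h x l =>
      rw [tensorMap_tmul, tensorMap_tmul, h.apply_apply_eq_zero]
      exact DFunLike.congr_fun (map_zero (tmulHom Z L)) _
    | h0 => simp only [map_zero]
    | hadd a b ha hb => rw [map_add, map_add, ha, hb, add_zero]

lemma tensorMap_right_exact (X : RMod R) {L M N : ModuleCat.{u} R} {f : L ⟶ M} {q : M ⟶ N}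
    (h : Function.Exact f q) (hq : Function.Surjective q) :
    Function.Exact (tensorMap (𝟙 X) f) (tensorMap (𝟙 X) q) := by
  let I : AddSubgroup (tensor X M) := (tensorMap (𝟙 X) f).hom.range
  let π : tensor X M →+ tensor X M ⧸ I := QuotientAddGroup.mk' I
  have key : ∀ x y y', q y = q y' → π (tmul x y) = π (tmul x y') := by
    intro x y y' e
    obtain ⟨l, hl⟩ := (h (y - y')).1 (by rw [map_sub, e, sub_self])
    rw [← sub_eq_zero, ← map_sub]
    refine (QuotientAddGroup.eq_zero_iff _).2 ⟨tmul x l, ?_⟩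
    change tmul x (f l) = _
    rw [hl]
    exact map_sub (tmulHom X M x) y y'
  obtain ⟨σ, hσ⟩ := hq.hasRightInverse
  let s : tensor X N →+ tensor X M ⧸ I := tensorLift
    (AddMonoidHom.mk' (fun x => AddMonoidHom.mk' (fun z => π (tmul x (σ z))) fun z z' => by
      rw [← map_add, ← tmul_add]
      apply key
      rw [map_add, hσ, hσ, hσ]) fun x x' => AddMonoidHom.ext fun z => by
        change π _ = π _ + π _
        rw [add_tmul, map_add])
    fun x r z => by
      change π (tmul _ _) = π (tmul _ _)
      rw [op_smul_tmul]
      apply key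
      rw [map_smul, hσ, hσ]
  have hs : ∀ t, s (tensorMap (𝟙 X) q t) = π t := by
    intro t
    induction t using tensor_induction with
    | h x y => exact key _ _ _ (hσ _)
    | h0 => simp only [map_zero]
    | hadd a b ha hb => rw [map_add, map_add, map_add, ha, hb]
  intro t
  constructor
  · intro ht
    exact (QuotientAddGroup.eq_zero_iff t).1 ((hs t).symm.trans (by rw [ht, map_zero]))
  · rintro ⟨t, rfl⟩
    induction t using tensor_induction with
    | h x l =>
      rw [tensorMap_tmul, tensorMap_tmul, h.apply_apply_eq_zero]
      exact map_zero (tmulHom X N _)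
    | h0 => simp only [map_zero]
    | hadd a b ha hb => rw [map_add, map_add, ha, hb, add_zero]

variable (R) in
/-- The functor `L ↦ - ⊗ L`, with values in the functors on all right modules. -/
def tU : FPMod R ⥤ AddFun (RMod R) :=
  (additiveFunctor _ _).lift ((isFPMod R).ι ⋙ (tensorFunctor R).flip)
    (fun L => (inferInstance : ((tensorFunctor R).flip.obj ((isFPMod R).ι.obj L)).Additive))

instance : (tU R).Additive where
  map_add {_ _ f g} := by
    apply ObjectProperty.hom_ext
    ext X : 2
    exact tensor_ext fun x l => tmul_add x (f.hom l) (g.hom l)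

lemma rightExactSeq_tR {X Y Z : RMod R} {f : X ⟶ Y} {q : Y ⟶ Z} (h : Function.Exact f q)
    (hq : Function.Surjective q) : RightExactSeq ((tR R).map f) ((tR R).map q) :=
  fun L => ⟨tensorMap_left_exact h hq L.obj, tensorMap_left_surjective hq L.obj⟩

lemma rightExactSeq_tU {L M N : FPMod R} {f : L ⟶ M} {q : M ⟶ N}
    (h : Function.Exact f.hom q.hom) (hq : Function.Surjective q.hom) :
    RightExactSeq ((tU R).map f) ((tU R).map q) :=
  fun X => ⟨tensorMap_right_exact X h hq, tensorMap_right_surjective X hq⟩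

lemma rightExactSeq_tL {L M N : FPMod R} {f : L ⟶ M} {q : M ⟶ N}
    (h : Function.Exact f.hom q.hom) (hq : Function.Surjective q.hom) :
    RightExactSeq ((tL R).map f) ((tL R).map q) :=
  fun X => ⟨tensorMap_right_exact X.obj h hq, tensorMap_right_surjective X.obj hq⟩

end TensorExact

/-! ### Finitely presented modules: free presentations, cokernels, pushouts -/

section Modules

variable (S : Type u) [Ring S]

/-- The free module of rank `n`. -/
def freeFP (n : ℕ) : FPMod S :=
  ⟨ModuleCat.of S (Fin n → S), (inferInstance : Module.FinitePresentation S (Fin n → S))⟩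

variable {S}

/-- The map from a free module with given values on the basis. -/
def freeDesc {n : ℕ} {M : ModuleCat.{u} S} (m : Fin n → M) : (freeFP S n).obj ⟶ M :=
  ModuleCat.ofHom (Fintype.linearCombination S m)

/-- The basis elements of a free module. -/
def freeBasis {n : ℕ} (i : Fin n) : (freeFP S n).obj := (Pi.single i 1 : Fin n → S)

@[simp]
lemma freeDesc_basis {n : ℕ} {M : ModuleCat.{u} S} (m : Fin n → M) (i : Fin n) :
    freeDesc m (freeBasis i) = m i := by
  change Fintype.linearCombination S m (Pi.single i 1) = m i
  rw [Fintype.linearCombination_apply_single, one_smul]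

lemma free_sum {n : ℕ} (v : Fin n → S) :
    ∑ i, v i • freeBasis i = (show (freeFP S n).obj from v) := by
  change (∑ i, v i • Pi.single i (1 : S) : Fin n → S) = v
  exact (pi_eq_sum_univ' v).symm

lemma free_ext {n : ℕ} {M : ModuleCat.{u} S} {f g : (freeFP S n).obj ⟶ M}
    (h : ∀ i, f (freeBasis i) = g (freeBasis i)) : f = g := by
  apply ModuleCat.hom_ext
  exact LinearMap.pi_ext' fun i => LinearMap.ext_ring (h i)

lemma exists_free_presentation (L : FPMod S) : ∃ (m n : ℕ) (f : freeFP S m ⟶ freeFP S n)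
    (q : freeFP S n ⟶ L), Function.Exact f.hom q.hom ∧ Function.Surjective q.hom := by
  have hL : Module.FinitePresentation S L.obj := L.property
  obtain ⟨n, q, hq⟩ := Module.Finite.exists_fin' S L.obj
  have hfg := Module.FinitePresentation.fg_ker q hq
  have : Module.Finite S (LinearMap.ker q) := Module.Finite.of_fg hfg
  obtain ⟨m, f, hf⟩ := Module.Finite.exists_fin' S (LinearMap.ker q)
  refine ⟨m, n, ObjectProperty.homMk (ModuleCat.ofHom ((LinearMap.ker q).subtype.comp f)),
    ObjectProperty.homMk (ModuleCat.ofHom q), fun x => ⟨fun hx => ?_, ?_⟩, hq⟩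
  · obtain ⟨y, hy⟩ := hf ⟨x, hx⟩
    exact ⟨y, congrArg Subtype.val hy⟩
  · rintro ⟨y, rfl⟩
    exact (f y).2

lemma exists_cokernel {L M : FPMod S} (f : L ⟶ M) : ∃ (N : FPMod S) (q : M ⟶ N),
    Function.Exact f.hom q.hom ∧ Function.Surjective q.hom := by
  have hL : Module.FinitePresentation S L.obj := L.property
  have hM : Module.FinitePresentation S M.obj := M.property
  let I := LinearMap.range f.hom.hom
  have hI : I.FG := by
    change (LinearMap.range f.hom.hom).FG
    rw [← Submodule.map_top f.hom.hom]
    exact Submodule.FG.map _ Module.Finite.fg_top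
  have hN : Module.FinitePresentation S (M.obj ⧸ I) :=
    Module.finitePresentation_of_surjective I.mkQ I.mkQ_surjective (by rwa [Submodule.ker_mkQ])
  refine ⟨⟨ModuleCat.of S (M.obj ⧸ I), hN⟩, ObjectProperty.homMk (ModuleCat.ofHom I.mkQ),
    fun x => ?_, I.mkQ_surjective⟩
  exact Submodule.Quotient.mk_eq_zero I

/-- Finite presentation of `P` is kept as an implication so that one construction serves all
modules, the finitely presented ones inside them, and the category of finitely presented ones. -/
lemma exists_pushout {X' X Y' : ModuleCat.{u} S} (h : X' ⟶ X) (f : X' ⟶ Y') :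
    ∃ (P : ModuleCat.{u} S) (_ : isFPMod S X' → isFPMod S X → isFPMod S Y' → isFPMod S P)
      (a : X ⟶ P) (b : Y' ⟶ P), h ≫ a = f ≫ b ∧
      ∀ ⦃A : ModuleCat.{u} S⦄ (s : X ⟶ A) (t : Y' ⟶ A), h ≫ s = f ≫ t →
        ∃ c : P ⟶ A, a ≫ c = s := by
  let d : X' →ₗ[S] X × Y' := h.hom.prod (-f.hom)
  let I := LinearMap.range d
  refine ⟨ModuleCat.of S ((X × Y') ⧸ I), fun h₁ h₂ h₃ => ?_,
    ModuleCat.ofHom (I.mkQ.comp (LinearMap.inl S X Y')),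
    ModuleCat.ofHom (I.mkQ.comp (LinearMap.inr S X Y')), ?_, fun A s t hst => ?_⟩
  · have h₁' : Module.FinitePresentation S X' := h₁
    have h₂' : Module.FinitePresentation S X := h₂
    have h₃' : Module.FinitePresentation S Y' := h₃
    refine Module.finitePresentation_of_surjective I.mkQ I.mkQ_surjective ?_
    rw [Submodule.ker_mkQ]
    change (LinearMap.range d).FG
    rw [← Submodule.map_top d]
    exact Submodule.FG.map _ Module.Finite.fg_top
  · ext x
    refine (Submodule.Quotient.eq I).2 ⟨x, ?_⟩
    change (h x, -f x) = (h x, 0) - (0, f x)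
    rw [Prod.mk_sub_mk, sub_zero, zero_sub]
  · refine ⟨ModuleCat.ofHom (I.liftQ (s.hom.coprod t.hom) ?_), ?_⟩
    · rintro _ ⟨x, rfl⟩
      change s (h x) + t (-f x) = 0
      rw [map_neg, ← sub_eq_add_neg, sub_eq_zero]
      exact ConcreteCategory.congr_hom hst x
    · ext x
      change s x + t 0 = s x
      rw [map_zero, add_zero]

lemma hasWeakPushouts_top_module : HasWeakPushouts (⊤ : ObjectProperty (ModuleCat.{u} S)) := by
  intro X' X Y' _ _ _ h f
  obtain ⟨P, _, H⟩ := exists_pushout h f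
  exact ⟨P, trivial, H⟩

lemma hasWeakPushouts_isFPMod : HasWeakPushouts (isFPMod S) := by
  intro X' X Y' h₁ h₂ h₃ h f
  obtain ⟨P, hP, H⟩ := exists_pushout h f
  exact ⟨P, hP h₁ h₂ h₃, H⟩

lemma hasWeakPushouts_fpMod : HasWeakPushouts (⊤ : ObjectProperty (FPMod S)) := by
  intro X' X Y' _ _ _ h f
  obtain ⟨P, hP, a, b, hab, H⟩ := exists_pushout h.hom f.hom
  refine ⟨⟨P, hP X'.property X.property Y'.property⟩, trivial, ObjectProperty.homMk a,
    ObjectProperty.homMk b, ObjectProperty.hom_ext _ hab, fun A s t hst => ?_⟩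
  obtain ⟨c, hc⟩ := H s.hom t.hom (congrArg InducedCategory.Hom.hom hst)
  exact ⟨ObjectProperty.homMk c, ObjectProperty.hom_ext _ hc⟩

end Modules

/-! ### Tensor functors are finitely presented -/

section TensorFP

variable {R : Type u} [Ring R]

lemma tmul_sum {X : RMod R} {L : ModuleCat.{u} R} {n : ℕ} (x : X) (l : Fin n → L) :
    tmul x (∑ i, l i) = ∑ i, tmul x (l i) :=
  map_sum (tmulHom X L x) l Finset.univ

lemma sum_tmul {X : RMod R} {L : ModuleCat.{u} R} {n : ℕ} (x : Fin n → X) (l : L) :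
    tmul (∑ i, x i) l = ∑ i, tmul (x i) l :=
  map_sum ((tmulHom X L).flip l) x Finset.univ

/-- Pure tensors as elements of the functor `X ⊗ -`. -/
def tmR {X : RMod R} {L : FPMod R} (x : X) (l : L.obj) : ev ((tR R).obj X) L := tmul x l

/-- Pure tensors as elements of the functor `- ⊗ L`. -/
def tmL {X : FPMod Rᵐᵒᵖ} {L : FPMod R} (x : X.obj) (l : L.obj) : ev ((tL R).obj L) X := tmul x l

lemma tmR_add_left {X : RMod R} {L : FPMod R} (x x' : X) (l : L.obj) :
    (tmR (x + x') l : ev ((tR R).obj X) L) = tmR x l + tmR x' l := add_tmul x x' l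

lemma tmL_add_right {X : FPMod Rᵐᵒᵖ} {L : FPMod R} (x : X.obj) (l l' : L.obj) :
    (tmL x (l + l') : ev ((tL R).obj L) X) = tmL x l + tmL x l' := tmul_add x l l'

lemma tmR_op_smul {X : RMod R} {L : FPMod R} (r : R) (x : X) (l : L.obj) :
    (tmR (MulOpposite.op r • x) l : ev ((tR R).obj X) L) = tmR x (r • l) := op_smul_tmul r x l

lemma tmL_op_smul {X : FPMod Rᵐᵒᵖ} {L : FPMod R} (r : R) (x : X.obj) (l : L.obj) :
    (tmL (MulOpposite.op r • x) l : ev ((tL R).obj L) X) = tmL x (r • l) := op_smul_tmul r x l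

lemma act_tmR {X : RMod R} {L M : FPMod R} (f : L ⟶ M) (x : X) (l : L.obj) :
    act ((tR R).obj X) f (tmR x l) = tmR x (f.hom l) := rfl

lemma act_tmL {X Y : FPMod Rᵐᵒᵖ} {L : FPMod R} (f : X ⟶ Y) (x : X.obj) (l : L.obj) :
    act ((tL R).obj L) f (tmL x l) = tmL (f.hom x) l := rfl

lemma app_map_tmR {X Y : RMod R} {L : FPMod R} (f : X ⟶ Y) (x : X) (l : L.obj) :
    app ((tR R).map f) L (tmR x l) = tmR (f x) l := rfl

lemma app_map_tmL {X : FPMod Rᵐᵒᵖ} {L M : FPMod R} (f : L ⟶ M) (x : X.obj) (l : L.obj) :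
    app ((tL R).map f) X (tmL x l) = tmL x (f.hom l) := rfl

lemma tR_nat_ext {X : RMod R} {F : AddFun (FPMod R)} {α β : (tR R).obj X ⟶ F}
    (h : ∀ L (x : X) (l : L.obj), app α L (tmR x l) = app β L (tmR x l)) : α = β := by
  refine nat_ext fun L t => ?_
  refine tensor_induction (P := fun t => app α L t = app β L t) (h L) ?_ (fun s t hs ht => ?_) t
  · exact (map_zero (app α L)).trans (map_zero (app β L)).symm
  · exact (map_add (app α L) s t).trans
      ((congrArg₂ (· + ·) hs ht).trans (map_add (app β L) s t).symm)

lemma tL_nat_ext {L : FPMod R} {F : AddFun (FPMod Rᵐᵒᵖ)} {α β : (tL R).obj L ⟶ F}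
    (h : ∀ X (x : X.obj) (l : L.obj), app α X (tmL x l) = app β X (tmL x l)) : α = β := by
  refine nat_ext fun X t => ?_
  refine tensor_induction (P := fun t => app α X t = app β X t) (h X) ?_ (fun s t hs ht => ?_) t
  · exact (map_zero (app α X)).trans (map_zero (app β X)).symm
  · exact (map_add (app α X) s t).trans
      ((congrArg₂ (· + ·) hs ht).trans (map_add (app β X) s t).symm)

/-- The canonical element of `Rⁿ ⊗ Rⁿ`. -/
def coev (R : Type u) [Ring R] (n : ℕ) : tensor (freeFP Rᵐᵒᵖ n).obj (freeFP R n).obj :=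
  ∑ i, tmul (freeBasis i) (freeBasis i)

/-- The natural map `(Rⁿ, M) ⟶ M ⊗ Rⁿ`. -/
def coevU (R : Type u) [Ring R] (n : ℕ) : rep (freeFP Rᵐᵒᵖ n).obj ⟶ (tU R).obj (freeFP R n) :=
  yo (show ev ((tU R).obj (freeFP R n)) (freeFP Rᵐᵒᵖ n).obj from coev R n)

/-- The natural map `(Rⁿ, L) ⟶ Rⁿ ⊗ L`. -/
def coevR (R : Type u) [Ring R] (n : ℕ) : rep (freeFP R n) ⟶ (tR R).obj (freeFP Rᵐᵒᵖ n).obj :=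
  yo (show ev ((tR R).obj (freeFP Rᵐᵒᵖ n).obj) (freeFP R n) from coev R n)

/-- `M ⊗ Rⁿ ⟶ Mⁿ`. -/
def tensorFreeRight (M : RMod R) (n : ℕ) : tensor M (freeFP R n).obj →+ (Fin n → M) :=
  tensorLift
    (AddMonoidHom.mk' (fun m => AddMonoidHom.mk'
      (fun v i => MulOpposite.op ((show Fin n → R from v) i) • m)
      (fun v v' => funext fun i => add_smul (MulOpposite.op ((show Fin n → R from v) i))
        (MulOpposite.op ((show Fin n → R from v') i)) m))
      fun m m' => by
        ext v i
        exact smul_add _ m m')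
    fun m r v => funext fun i => by
      change MulOpposite.op ((show Fin n → R from v) i) • MulOpposite.op r • m =
        MulOpposite.op (r * (show Fin n → R from v) i) • m
      rw [smul_smul, MulOpposite.op_mul]

/-- `Rⁿ ⊗ L ⟶ Lⁿ`. -/
def tensorFreeLeft (L : ModuleCat.{u} R) (n : ℕ) : tensor (freeFP Rᵐᵒᵖ n).obj L →+ (Fin n → L) :=
  tensorLift
    (AddMonoidHom.mk' (fun v => AddMonoidHom.mk'
      (fun l i => MulOpposite.unop ((show Fin n → Rᵐᵒᵖ from v) i) • l)
      (fun l l' => funext fun i => smul_add _ l l'))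
      fun v v' => by
        ext l i
        exact add_smul (MulOpposite.unop ((show Fin n → Rᵐᵒᵖ from v) i))
          (MulOpposite.unop ((show Fin n → Rᵐᵒᵖ from v') i)) l)
    fun v r l => funext fun i => by
      change MulOpposite.unop (MulOpposite.op r * (show Fin n → Rᵐᵒᵖ from v) i) • l =
        MulOpposite.unop ((show Fin n → Rᵐᵒᵖ from v) i) • r • l
      rw [smul_smul, MulOpposite.unop_mul, MulOpposite.unop_op]

lemma app_coevU {n : ℕ} {M : RMod R} (h : (freeFP Rᵐᵒᵖ n).obj ⟶ M) :
    app (coevU R n) M (el h) = ∑ i, tmul (h (freeBasis i)) (freeBasis i) :=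
  map_sum (act ((tU R).obj (freeFP R n)) h) _ _

lemma app_coevR {n : ℕ} {L : FPMod R} (h : freeFP R n ⟶ L) :
    app (coevR R n) L (el h) = ∑ i, tmul (freeBasis i) (h.hom (freeBasis i)) :=
  map_sum (act ((tR R).obj (freeFP Rᵐᵒᵖ n).obj) h) _ _

/-- The map is `h ↦ ∑ h(eᵢ) ⊗ eᵢ`. Taking coordinates in `Mⁿ` recovers the values `h(eᵢ)`, and every
`m ⊗ v` equals `∑ m vᵢ ⊗ eᵢ`. -/
lemma bijective_coevU (n : ℕ) (M : RMod R) :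
    Function.Bijective (app (coevU R n) M) := by
  constructor
  · intro h k e
    obtain ⟨h, rfl⟩ := exists_el h
    obtain ⟨k, rfl⟩ := exists_el k
    have key : ∀ h : (freeFP Rᵐᵒᵖ n).obj ⟶ M, tensorFreeRight M n
        (app (coevU R n) M (el h)) =
          fun i => h (freeBasis i) := by
      intro h
      rw [app_coevU]
      refine (map_sum (tensorFreeRight M n) _ _).trans ?_
      funext j
      rw [Finset.sum_apply, Finset.sum_eq_single j]
      · change MulOpposite.op ((Pi.single j 1 : Fin n → R) j) • h (freeBasis j) = _
        rw [Pi.single_eq_same, MulOpposite.op_one, one_smul]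
      · intro i _ hij
        change MulOpposite.op ((Pi.single i 1 : Fin n → R) j) • h (freeBasis i) = _
        rw [Pi.single_eq_of_ne hij.symm, MulOpposite.op_zero, zero_smul]
      · intro hj
        exact absurd (Finset.mem_univ j) hj
    refine congrArg el (free_ext fun i => ?_)
    have := (key h).symm.trans ((congrArg _ e).trans (key k))
    exact congrFun this i
  · intro t
    induction t using tensor_induction with
    | h m v =>
      refine ⟨el (freeDesc fun i => MulOpposite.op ((show Fin n → R from v) i) • m), ?_⟩
      rw [app_coevU]
      simp only [freeDesc_basis, op_smul_tmul]
      rw [← tmul_sum]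
      exact congrArg (tmul m) (free_sum _)
    | h0 => exact ⟨0, map_zero _⟩
    | hadd s t hs ht =>
      obtain ⟨s, rfl⟩ := hs
      obtain ⟨t, rfl⟩ := ht
      exact ⟨s + t, map_add _ _ _⟩

lemma bijective_coevR (n : ℕ) (L : FPMod R) :
    Function.Bijective (app (coevR R n) L) := by
  constructor
  · intro h k e
    obtain ⟨h, rfl⟩ := exists_el h
    obtain ⟨k, rfl⟩ := exists_el k
    have key : ∀ h : freeFP R n ⟶ L, tensorFreeLeft L.obj n
        (app (coevR R n) L (el h)) =
          fun i => h.hom (freeBasis i) := by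
      intro h
      rw [app_coevR]
      refine (map_sum (tensorFreeLeft L.obj n) _ _).trans ?_
      funext j
      rw [Finset.sum_apply, Finset.sum_eq_single j]
      · change MulOpposite.unop ((Pi.single j 1 : Fin n → Rᵐᵒᵖ) j) • h.hom (freeBasis j) = _
        rw [Pi.single_eq_same, MulOpposite.unop_one, one_smul]
      · intro i _ hij
        change MulOpposite.unop ((Pi.single i 1 : Fin n → Rᵐᵒᵖ) j) • h.hom (freeBasis i) = _
        rw [Pi.single_eq_of_ne hij.symm, MulOpposite.unop_zero, zero_smul]
      · intro hj
        exact absurd (Finset.mem_univ j) hj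
    refine congrArg el (ObjectProperty.hom_ext _ (free_ext fun i => ?_))
    have := (key h).symm.trans ((congrArg _ e).trans (key k))
    exact congrFun this i
  · intro t
    induction t using tensor_induction with
    | h v l =>
      refine ⟨el (ObjectProperty.homMk
        (freeDesc fun i => MulOpposite.unop ((show Fin n → Rᵐᵒᵖ from v) i) • l)), ?_⟩
      rw [app_coevR]
      refine (Finset.sum_congr rfl fun i _ => (congrArg (tmul _) (freeDesc_basis _ i)).trans
        (op_smul_tmul _ _ l).symm).trans ?_
      rw [← sum_tmul]
      exact congrArg (fun x => tmul x l) (free_sum (S := Rᵐᵒᵖ) _)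
    | h0 => exact ⟨0, map_zero _⟩
    | hadd s t hs ht =>
      obtain ⟨s, rfl⟩ := hs
      obtain ⟨t, rfl⟩ := ht
      exact ⟨s + t, map_add _ _ _⟩

/-! ### Finite presentation and right exactness of the tensor functors -/

lemma isPP_iff_relFP {F : AddFun (RMod R)} : isPP R F ↔ relFP (isFPMod Rᵐᵒᵖ) F := by
  constructor
  · rintro ⟨X, Y, g, p, h⟩
    exact ⟨X.obj, Y.obj, X.property, Y.property, g, p, h⟩
  · rintro ⟨X, Y, hX, hY, g, p, h⟩
    exact ⟨⟨X, hX⟩, ⟨Y, hY⟩, g, p, h⟩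

/-- Tensoring a free presentation of `L` gives a presentation of `- ⊗ L` by the functors `- ⊗ Rⁿ ≅
(Rⁿ, -)`. -/
lemma relFP_tU (L : FPMod R) : relFP (isFPMod Rᵐᵒᵖ) ((tU R).obj L) := by
  obtain ⟨m, n, f, q, h, hq⟩ := exists_free_presentation L
  exact relFP_of_rightExactSeq (freeFP Rᵐᵒᵖ n).property (freeFP Rᵐᵒᵖ m).property
    (isoOfBijective _ (bijective_coevU m)) (isoOfBijective _ (bijective_coevU n))
    (rightExactSeq_tU h hq)

lemma isFPFun_tR (X : FPMod Rᵐᵒᵖ) : isFPFun (FPMod R) ((tR R).obj X.obj) := by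
  obtain ⟨m, n, f, q, h, hq⟩ := exists_free_presentation X
  exact isFPFun_of_relFP (relFP_of_rightExactSeq (Q := ⊤) trivial trivial
    (isoOfBijective _ (bijective_coevR m)) (isoOfBijective _ (bijective_coevR n))
    (rightExactSeq_tR h hq))

lemma isFPFun_tL (L : FPMod R) : isFPFun (FPMod Rᵐᵒᵖ) ((tL R).obj L) :=
  isFPFun_res R ⟨(tU R).obj L, isPP_iff_relFP.2 (relFP_tU L)⟩

/-- Right exactness is needed only in the finitely presented variable, so `X` may be any module;
biduality for `D_R` and `D_A` uses this at every module. -/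
lemma weakCokernelExact_tR (X : RMod R) : WeakCokernelExact ((tR R).obj X) := by
  intro L M f
  obtain ⟨N, q, h, hq⟩ := exists_cokernel f
  refine ⟨N, q, ObjectProperty.hom_ext _ ?_, fun y hy => ?_⟩
  · ext x
    exact h.apply_apply_eq_zero x
  · exact (tensorMap_right_exact X h hq y).1 hy

lemma weakCokernelExact_tL (L : FPMod R) : WeakCokernelExact ((tL R).obj L) := by
  intro X Y f
  obtain ⟨Z, q, h, hq⟩ := exists_cokernel f
  refine ⟨Z, q, ObjectProperty.hom_ext _ ?_, fun y hy => ?_⟩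
  · ext x
    exact h.apply_apply_eq_zero x
  · exact (tensorMap_left_exact h hq L.obj y).1 hy

/-! ### Full faithfulness of the tensor embeddings -/

/-- The ring as a finitely presented module over itself. -/
def selfFP (S : Type u) [Ring S] : FPMod S :=
  ⟨ModuleCat.of S S, (inferInstance : Module.FinitePresentation S S)⟩

/-- The unit of the ring, as an element of the module. -/
def one' (S : Type u) [Ring S] : (selfFP S).obj := (1 : S)

/-- The map `S ⟶ L` sending `1` to `l`. -/
def selfDesc {S : Type u} [Ring S] {L : FPMod S} (l : L.obj) : selfFP S ⟶ L :=
  ObjectProperty.homMk (ModuleCat.ofHom (LinearMap.toSpanSingleton S L.obj l))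

@[simp]
lemma selfDesc_one {S : Type u} [Ring S] {L : FPMod S} (l : L.obj) :
    (selfDesc l).hom (one' S) = l :=
  one_smul S l

/-- `M ⊗ R ⟶ M`. -/
def tensorSelfRight (M : RMod R) : ev ((tR R).obj M) (selfFP R) →+ M :=
  tensorLift (L := (selfFP R).obj)
    (AddMonoidHom.mk' (fun m => AddMonoidHom.mk'
      (fun s => MulOpposite.op (show R from s) • m)
      (fun s s' => add_smul (MulOpposite.op (show R from s)) (MulOpposite.op (show R from s')) m))
      fun m m' => by
        ext s
        exact smul_add _ m m')
    fun m r s => by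
      change MulOpposite.op (show R from s) • MulOpposite.op r • m =
        MulOpposite.op (r * (show R from s)) • m
      rw [smul_smul, MulOpposite.op_mul]

/-- `R ⊗ L ⟶ L`. -/
def tensorSelfLeft (L : FPMod R) : ev ((tL R).obj L) (selfFP Rᵐᵒᵖ) →+ L.obj :=
  tensorLift (X := (selfFP Rᵐᵒᵖ).obj)
    (AddMonoidHom.mk' (fun s => AddMonoidHom.mk'
      (fun l => MulOpposite.unop (show Rᵐᵒᵖ from s) • l)
      (fun l l' => smul_add _ l l'))
      fun s s' => by
        ext l
        exact add_smul (MulOpposite.unop (show Rᵐᵒᵖ from s))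
          (MulOpposite.unop (show Rᵐᵒᵖ from s')) l)
    fun s r l => by
      change MulOpposite.unop (MulOpposite.op r * (show Rᵐᵒᵖ from s)) • l =
        MulOpposite.unop (show Rᵐᵒᵖ from s) • r • l
      rw [smul_smul, MulOpposite.unop_mul, MulOpposite.unop_op]

lemma smul_one' {S : Type u} [Ring S] (s : (selfFP S).obj) : (show S from s) • one' S = s :=
  mul_one (show S from s)

lemma tensorSelfRight_one {M : RMod R} (m : M) : tensorSelfRight M (tmR m (one' R)) = m :=
  one_smul Rᵐᵒᵖ m

lemma tensorSelfLeft_one {L : FPMod R} (l : L.obj) :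
    tensorSelfLeft L (tmL (one' Rᵐᵒᵖ) l) = l :=
  one_smul R l

lemma tmR_tensorSelfRight {M : RMod R} (t : ev ((tR R).obj M) (selfFP R)) :
    tmR (tensorSelfRight M t) (one' R) = t := by
  refine tensor_induction (P := fun t => tmR (tensorSelfRight M t) (one' R) = t)
    (fun m s => ?_) ?_ (fun s t hs ht => ?_) t
  · refine (op_smul_tmul (show R from s) m (one' R)).trans ?_
    exact congrArg (tmul m) (smul_one' _)
  · exact DFunLike.congr_fun (map_zero (tmulHom M (selfFP R).obj)) _
  · refine (congrArg (fun m => tmR m (one' R)) (map_add (tensorSelfRight M) s t)).trans ?_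
    rw [tmR_add_left]
    exact congrArg₂ (· + ·) hs ht

lemma tmL_tensorSelfLeft {L : FPMod R} (t : ev ((tL R).obj L) (selfFP Rᵐᵒᵖ)) :
    tmL (one' Rᵐᵒᵖ) (tensorSelfLeft L t) = t := by
  refine tensor_induction (P := fun t => tmL (one' Rᵐᵒᵖ) (tensorSelfLeft L t) = t)
    (fun s l => ?_) ?_ (fun s t hs ht => ?_) t
  · refine (op_smul_tmul (MulOpposite.unop (show Rᵐᵒᵖ from s)) (one' Rᵐᵒᵖ) l).symm.trans ?_
    exact congrArg (fun x => tmul x l) (smul_one' (S := Rᵐᵒᵖ) _)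
  · exact map_zero (tmulHom (selfFP Rᵐᵒᵖ).obj L.obj _)
  · refine (congrArg (tmL (one' Rᵐᵒᵖ)) (map_add (tensorSelfLeft L) s t)).trans ?_
    rw [tmL_add_right]
    exact congrArg₂ (· + ·) hs ht

lemma tensorSelfRight_act {M : RMod R} (r : R) (t : ev ((tR R).obj M) (selfFP R)) :
    tensorSelfRight M (act ((tR R).obj M) (selfDesc (r • one' R)) t) =
      MulOpposite.op r • tensorSelfRight M t := by
  obtain ⟨m, rfl⟩ : ∃ m, tmR m (one' R) = t := ⟨_, tmR_tensorSelfRight t⟩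
  rw [tensorSelfRight_one, act_tmR, selfDesc_one, ← tmR_op_smul, tensorSelfRight_one]

lemma tensorSelfLeft_act {L : FPMod R} (r : R) (t : ev ((tL R).obj L) (selfFP Rᵐᵒᵖ)) :
    tensorSelfLeft L (act ((tL R).obj L) (selfDesc (MulOpposite.op r • one' Rᵐᵒᵖ)) t) =
      r • tensorSelfLeft L t := by
  obtain ⟨l, rfl⟩ : ∃ l, tmL (one' Rᵐᵒᵖ) l = t := ⟨_, tmL_tensorSelfLeft t⟩
  rw [tensorSelfLeft_one, act_tmL, selfDesc_one, tmL_op_smul, tensorSelfLeft_one]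

instance : (tR R).Faithful where
  map_injective {X M f g} e := by
    ext x
    have h : tmR (f x) (one' R) = tmR (g x) (one' R) :=
      congrArg (fun α => app α (selfFP R) (tmR x (one' R))) e
    rw [← tensorSelfRight_one (f x), h, tensorSelfRight_one]

instance : (tL R).Faithful where
  map_injective {L M f g} e := by
    apply ObjectProperty.hom_ext
    ext x
    have h : tmL (one' Rᵐᵒᵖ) (f.hom x) = tmL (one' Rᵐᵒᵖ) (g.hom x) :=
      congrArg (fun α => app α (selfFP Rᵐᵒᵖ) (tmL (one' Rᵐᵒᵖ) x)) e
    rw [← tensorSelfLeft_one (f.hom x), h, tensorSelfLeft_one]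

/-- A transformation is determined by its component at `R`, where `M ⊗ R ≅ M`. Naturality for the
endomorphisms `1 ↦ r` of `R` makes that component linear, and naturality for `R ⟶ L`, `1 ↦ l`,
recovers all the other components. -/
instance : (tR R).Full where
  map_surjective {X M} ν := by
    let h : X →ₗ[Rᵐᵒᵖ] M :=
      { toFun := fun x => tensorSelfRight M (app ν (selfFP R) (tmR x (one' R)))
        map_add' := fun x y => by rw [tmR_add_left, map_add, map_add]
        map_smul' := fun r x => by
          obtain ⟨r, rfl⟩ := MulOpposite.op_surjective r
          rw [tmR_op_smul, ← selfDesc_one (L := selfFP R) (r • one' R), ← act_tmR, app_act]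
          exact tensorSelfRight_act r _ }
    refine ⟨ModuleCat.ofHom h, tR_nat_ext fun L x l => ?_⟩
    rw [app_map_tmR, ← selfDesc_one l, ← act_tmR, ← act_tmR, app_act]
    exact congrArg _ (tmR_tensorSelfRight _)

instance : (tL R).Full where
  map_surjective {L M} ν := by
    let h : L.obj →ₗ[R] M.obj :=
      { toFun := fun x => tensorSelfLeft M (app ν (selfFP Rᵐᵒᵖ) (tmL (one' Rᵐᵒᵖ) x))
        map_add' := fun x y => by rw [tmL_add_right, map_add, map_add]
        map_smul' := fun r x => by
          rw [← tmL_op_smul, ← selfDesc_one (L := selfFP Rᵐᵒᵖ) (MulOpposite.op r • one' Rᵐᵒᵖ),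
            ← act_tmL, app_act]
          exact tensorSelfLeft_act r _ }
    refine ⟨ObjectProperty.homMk (ModuleCat.ofHom h), tL_nat_ext fun X x l => ?_⟩
    rw [app_map_tmL, ← selfDesc_one x, ← act_tmL, ← act_tmL, app_act]
    exact congrArg _ (tmL_tensorSelfLeft _)

end TensorFP

/-! ### Natural transformations out of a presented functor -/

section NatPres

variable {J : Type w} [Category.{v} J] [Preadditive J] {F H : AddFun J} {X Y : J}
  {g : rep Y ⟶ rep X} {p : rep X ⟶ F}

lemma RightExactSeq.nat_ext (h : RightExactSeq g p) {μ ν : F ⟶ H}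
    (e : app μ X (app p X (el (𝟙 X))) = app ν X (app p X (el (𝟙 X)))) : μ = ν :=
  surj_ext (fun A => (h A).2) (rep_ext (α := p ≫ μ) (β := p ≫ ν) e)

/-- With `RightExactSeq.nat_ext` this is the formula `Nat(F, H) = ker (H X ⟶ H Y)`: by Yoneda `x` is
a map `(X, -) ⟶ H`, and it descends to `F` when it kills the relations. -/
lemma RightExactSeq.exists_nat_iff (h : RightExactSeq g p) (x : ev H X) :
    act H (repMap g) x = 0 ↔ ∃ μ : F ⟶ H, app μ X (app p X (el (𝟙 X))) = x := by
  constructor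
  · intro hx
    obtain ⟨μ, hμ⟩ := exists_desc h (yo x) (rep_ext hx)
    refine ⟨μ, ?_⟩
    rw [← app_comp, hμ, app_yo, act_id]
  · rintro ⟨μ, rfl⟩
    rw [← app_act, ← app_act, act_el, Category.id_comp,
      (h.app_eq_zero_iff _).2 ⟨𝟙 Y, Category.comp_id _⟩, map_zero]

end NatPres

/-! ### Products of finitely presented functors -/

section Products

variable {C : Type w} [Category.{u} C] [Preadditive C]

/-- The product of a family of additive functors. -/
def piFun {I : Type u} (F : I → AddFun C) : AddFun C where
  obj :=
    { obj A := AddCommGrpCat.of (∀ i, ev (F i) A)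
      map f := AddCommGrpCat.ofHom (AddMonoidHom.mk' (fun x i => act (F i) f (x i))
        fun x y => funext fun i => map_add _ _ _)
      map_id A := by
        ext x i
        exact act_id A (x i)
      map_comp f g := by
        ext x i
        exact act_comp f g (x i) }
  property :=
    { map_add {A B f g} := by
        ext x i
        exact act_add f g (x i) }

/-- The projections of the product. -/
def piProj {I : Type u} (F : I → AddFun C) (i : I) : piFun F ⟶ F i :=
  mkNat (fun A => Pi.evalAddMonoidHom (fun i => ev (F i) A) i) fun _ _ => rfl

/-- The map to the product with given components. -/
def piLift {I : Type u} {F : I → AddFun C} {G : AddFun C} (α : ∀ i, G ⟶ F i) : G ⟶ piFun F :=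
  mkNat (fun A => AddMonoidHom.mk' (fun x i => app (α i) A x)
    fun x y => funext fun i => map_add (app (α i) A) x y)
    fun f x => funext fun i => app_act (α i) f x

lemma piFun_ext {I : Type u} {F : I → AddFun C} {A : C} {x y : ev (piFun F) A}
    (h : ∀ i, app (piProj F i) A x = app (piProj F i) A y) : x = y := funext h

/-- A product of functors `(Xᵢ, -)` is represented by the coproduct of the `Xᵢ`, and products of
abelian groups are exact. -/
lemma isFPFun_piFun [HasCoproducts.{u} C] {I : Type u} (F : I → AddFun C)
    (hF : ∀ i, isFPFun C (F i)) : isFPFun C (piFun F) := by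
  choose X Y g p h using hF
  let q : rep (∐ X) ⟶ piFun F := piLift fun i => yo (el (Sigma.ι X i)) ≫ p i
  have hq : ∀ {A} (a : ∐ X ⟶ A) i,
      app (piProj F i) A (app q A (el a)) = app (p i) A (el (Sigma.ι X i ≫ a)) :=
    fun a i => rfl
  refine ⟨∐ X, ∐ Y, yo (el (Limits.Sigma.map fun i => repMap (g i))), q, fun A => ⟨?_, ?_⟩⟩
  · intro a
    obtain ⟨a, rfl⟩ := exists_el a
    constructor
    · intro ha
      have ha' : ∀ i, app (p i) A (el (Sigma.ι X i ≫ a)) = 0 := fun i =>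
        (hq a i).symm.trans ((congrArg _ ha).trans (map_zero (app (piProj F i) A)))
      choose b hb using fun i => ((h i).app_eq_zero_iff _).1 (ha' i)
      refine ⟨el (Sigma.desc b), congrArg el (Sigma.hom_ext _ _ fun i => ?_)⟩
      refine (Sigma.ι_map_assoc _ _ _).trans ?_
      refine (congrArg (repMap (g i) ≫ ·) (Sigma.ι_desc b i)).trans (hb i)
    · rintro ⟨b, hb⟩
      obtain ⟨b, rfl⟩ := exists_el b
      have hb' : (Limits.Sigma.map fun i => repMap (g i)) ≫ b = a := hb
      refine piFun_ext fun i => (hq a i).trans ?_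
      rw [map_zero]
      refine ((h i).app_eq_zero_iff _).2 ⟨Sigma.ι Y i ≫ b, ?_⟩
      rw [← hb', Sigma.ι_map_assoc]
  · intro y
    choose a ha using fun i => (h i).exists_app_eq (app (piProj F i) A y)
    refine ⟨el (Sigma.desc a), piFun_ext fun i => (hq (Sigma.desc a) i).trans ?_⟩
    rw [Sigma.ι_desc, ha]

end Products

/-! ### Finite presentation of the dual functors -/

section DualFP

variable {R : Type u} [Ring R]

/-- The evaluation `Nat(G, M ⊗ -) → M ⊗ L` at an element of `G L`. -/
def evalDR (G : AddFun (FPMod R)) {L : FPMod R} (y : ev G L) :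
    natDualObj (tR R) G ⟶ (tU R).obj L :=
  mkNat (fun M => AddMonoidHom.mk' (fun z => app (ndHom z) L y) fun z z' => by
      rw [map_add, app_add]
      rfl)
    fun {M N} f z => by
      exact congrArg (fun μ => app μ L y) (ndHom_act f z)

lemma evalDR_injective {G : AddFun (FPMod R)} {L L' : FPMod R} {g : rep L' ⟶ rep L}
    {p : rep L ⟶ G} (h : RightExactSeq g p) (M : RMod R) :
    Function.Injective (app (evalDR G (app p L (el (𝟙 L)))) M) :=
  fun _ _ e => ndHom.injective (h.nat_ext e)

/-- Together with injectivity, this exhibits `D_R G` as the kernel of `- ⊗ L ⟶ - ⊗ L'` on all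
modules. -/
lemma exactSeq_evalDR {G : AddFun (FPMod R)} {L L' : FPMod R} {g : rep L' ⟶ rep L}
    {p : rep L ⟶ G} (h : RightExactSeq g p) :
    ExactSeq (evalDR G (app p L (el (𝟙 L)))) ((tU R).map (repMap g)) := by
  intro M t
  refine (h.exists_nat_iff (H := (tR R).obj M) t).trans ?_
  constructor
  · rintro ⟨μ, hμ⟩
    exact ⟨ndHom.symm μ, (congrArg (fun ν => app ν L _) (ndHom.apply_symm_apply μ)).trans hμ⟩
  · rintro ⟨z, hz⟩
    exact ⟨ndHom z, hz⟩

/-- Closure under kernels is applied relative to the finitely presented modules: pushouts of these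
are finitely presented and have their weak universal property against all modules. -/
lemma isPP_DR (G : FPFun (FPMod R)) : isPP R ((DR R).obj (op G.obj)) := by
  obtain ⟨L, L', g, p, h⟩ := G.property
  exact isPP_iff_relFP.2 (relFP_of_ker hasWeakPushouts_isFPMod (relFP_tU L) (relFP_tU L')
    (evalDR_injective h) (exactSeq_evalDR h))

lemma isFPFun_D' (G : FPFun (FPMod R)) : isFPFun (FPMod Rᵐᵒᵖ) ((D' R).obj (op G.obj)) :=
  isFPFun_res R ⟨(DR R).obj (op G.obj), isPP_DR G⟩

/-- The evaluation `Nat(F, - ⊗ L) → X ⊗ L` at an element of `F X`. -/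
def evalD (F : AddFun (FPMod Rᵐᵒᵖ)) {X : FPMod Rᵐᵒᵖ} (x : ev F X) :
    natDualObj (tL R) F ⟶ (tR R).obj X.obj :=
  mkNat (fun L => AddMonoidHom.mk' (fun z => app (ndHom z) X x) fun z z' => by
      rw [map_add, app_add]
      rfl)
    fun {M N} f z => by
      exact congrArg (fun μ => app μ X x) (ndHom_act f z)

lemma evalD_injective {F : AddFun (FPMod Rᵐᵒᵖ)} {X Y : FPMod Rᵐᵒᵖ} {g : rep Y ⟶ rep X}
    {p : rep X ⟶ F} (h : RightExactSeq g p) (L : FPMod R) :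
    Function.Injective (app (evalD F (app p X (el (𝟙 X)))) L) :=
  fun _ _ e => ndHom.injective (h.nat_ext e)

lemma exactSeq_evalD {F : AddFun (FPMod Rᵐᵒᵖ)} {X Y : FPMod Rᵐᵒᵖ} {g : rep Y ⟶ rep X}
    {p : rep X ⟶ F} (h : RightExactSeq g p) :
    ExactSeq (evalD F (app p X (el (𝟙 X)))) ((tR R).map (repMap g).hom) := by
  intro L t
  refine (h.exists_nat_iff (H := (tL R).obj L) t).trans ?_
  constructor
  · rintro ⟨μ, hμ⟩
    exact ⟨ndHom.symm μ,
      (congrArg (fun ν => app ν X _) (ndHom.apply_symm_apply μ)).trans hμ⟩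
  · rintro ⟨z, hz⟩
    exact ⟨ndHom z, hz⟩

lemma isFPFun_D (F : FPFun (FPMod Rᵐᵒᵖ)) : isFPFun (FPMod R) ((D R).obj (op F.obj)) := by
  obtain ⟨X, Y, g, p, h⟩ := F.property
  exact isFPFun_of_relFP (relFP_of_ker hasWeakPushouts_fpMod
    (relFP_top_of_isFPFun (isFPFun_tR X)) (relFP_top_of_isFPFun (isFPFun_tR Y))
    (evalD_injective h) (exactSeq_evalD h))

/-! ### `D_R` on arbitrary functors: compatible families over a small model -/

/-- The functor from a small category equivalent to the category of finitely presented modules. -/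
abbrev fromSmall (R : Type u) [Ring R] : SmallModel.{u} (FPMod R) ⥤ FPMod R :=
  (equivSmallModel.{u} (FPMod R)).inverse

/-- The elements of a functor at representatives of all finitely presented modules. -/
abbrev SmallElt (G : AddFun (FPMod R)) : Type u := Σ s, ev G ((fromSmall R).obj s)

/-- Pairs of elements of a functor, and an operator on the first one. -/
abbrev SmallRel (G : AddFun (FPMod R)) : Type u :=
  Σ s, Σ s', (s ⟶ s') × ev G ((fromSmall R).obj s) × ev G ((fromSmall R).obj s')

/-- The map whose kernel consists of the compatible families. -/
def relMap (G : AddFun (FPMod R)) :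
    piFun (fun i : SmallElt G => (tU R).obj ((fromSmall R).obj i.1)) ⟶
      piFun (fun r : SmallRel G => (tU R).obj ((fromSmall R).obj r.2.1)) :=
  -- The single relation `m(a y + y') = a m(y) + m(y')`, over all `a`, `y`, `y'`, encodes additivity
  -- and naturality at once.
  piLift fun r =>
    piProj (fun i : SmallElt G => (tU R).obj ((fromSmall R).obj i.1))
        ⟨r.2.1, act G ((fromSmall R).map r.2.2.1) r.2.2.2.1 + r.2.2.2.2⟩ -
      (piProj (fun i : SmallElt G => (tU R).obj ((fromSmall R).obj i.1)) ⟨r.1, r.2.2.2.1⟩ ≫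
          (tU R).map ((fromSmall R).map r.2.2.1) +
        piProj (fun i : SmallElt G => (tU R).obj ((fromSmall R).obj i.1)) ⟨r.2.1, r.2.2.2.2⟩)

/-- A natural transformation as a family of elements. -/
def toFamily (G : AddFun (FPMod R)) : natDualObj (tR R) G ⟶
    piFun (fun i : SmallElt G => (tU R).obj ((fromSmall R).obj i.1)) :=
  piLift fun i => evalDR G i.2

/-- Every finitely presented module is isomorphic to a representative from the small model, and
naturality transports values along this isomorphism. -/
lemma toFamily_injective (G : AddFun (FPMod R)) (M : RMod R) :
    Function.Injective (app (toFamily G) M) := by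
  intro z z' e
  refine ndHom.injective (nat_ext fun L y => ?_)
  let i := (equivSmallModel.{u} (FPMod R)).unitIso.app L
  have h : app (ndHom z) _ (act G i.hom y) = app (ndHom z') _ (act G i.hom y) :=
    congrArg (app (piProj (fun i : SmallElt G => (tU R).obj ((fromSmall R).obj i.1))
      ⟨(equivSmallModel.{u} (FPMod R)).functor.obj L, act G i.hom y⟩) M) e
  have h' := congrArg (act _ i.inv) h
  rwa [← app_act, ← app_act, ← act_comp, i.hom_inv_id, act_id] at h'

/-- A compatible family of elements comes from a natural transformation. -/
lemma exists_nat_of_family (G H : AddFun (FPMod R))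
    (m : ∀ s, ev G ((fromSmall R).obj s) → ev H ((fromSmall R).obj s))
    (hm : ∀ s s' (a : s ⟶ s') y y', m s' (act G ((fromSmall R).map a) y + y') =
      act H ((fromSmall R).map a) (m s y) + m s' y') :
    ∃ μ : G ⟶ H, ∀ s y, app μ ((fromSmall R).obj s) y = m s y := by
  -- Additivity is the relation for an identity morphism; naturality is the relation with `y' = 0`.
  have hadd : ∀ s y y', m s (y + y') = m s y + m s y' := by
    intro s y y'
    have h := hm s s (𝟙 s) y y'
    rwa [CategoryTheory.Functor.map_id, act_id, act_id] at h
  have hact : ∀ s s' (a : s ⟶ s') y,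
      m s' (act G ((fromSmall R).map a) y) = act H ((fromSmall R).map a) (m s y) := by
    intro s s' a y
    have h0 : m s' 0 = 0 := by
      have h := hadd s' 0 0
      rw [add_zero] at h
      exact left_eq_add.1 h
    have h := hm s s' a y 0
    rwa [add_zero, h0, add_zero] at h
  let e := equivSmallModel.{u} (FPMod R)
  let i : ∀ L : FPMod R, L ≅ e.inverse.obj (e.functor.obj L) := fun L => e.unitIso.app L
  have hi : ∀ {L L' : FPMod R} (f : L ⟶ L'),
      f ≫ (i L').hom = (i L).hom ≫ e.inverse.map (e.functor.map f) :=
    fun f => e.unitIso.hom.naturality f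
  refine ⟨mkNat (fun L => AddMonoidHom.mk' (fun y => act H (i L).inv (m _ (act G (i L).hom y)))
    fun y y' => ?_) fun {L L'} f y => ?_, fun s y => ?_⟩
  · rw [map_add, hadd, map_add]
  · change act H (i L').inv (m _ (act G (i L').hom (act G f y))) =
      act H f (act H (i L).inv (m _ (act G (i L).hom y)))
    rw [← act_comp, hi, act_comp, hact, ← act_comp, ← act_comp]
    congr 2
    rw [Iso.comp_inv_eq, Category.assoc, hi, Iso.inv_hom_id_assoc]
  · change act H (i _).inv (m _ (act G (i _).hom y)) = _
    -- At a representative the comparison isomorphism need not be the identity. It does come from a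
    -- morphism of the small model, with which `m` commutes, so it cancels.
    obtain ⟨b, hb⟩ := e.inverse.map_surjective (i (e.inverse.obj s)).inv
    change (fromSmall R).map b = _ at hb
    rw [← hb, ← hact, hb, ← act_comp, Iso.hom_inv_id, act_id]

lemma exactSeq_toFamily (G : AddFun (FPMod R)) : ExactSeq (toFamily G) (relMap G) := by
  intro M m
  constructor
  · intro hm
    obtain ⟨μ, hμ⟩ := exists_nat_of_family G ((tR R).obj M)
      (fun s y => app (piProj _ (⟨s, y⟩ : SmallElt G)) M m) fun s s' a y y' =>
        sub_eq_zero.1 (congrArg (app (piProj _ (⟨s, s', a, y, y'⟩ : SmallRel G)) M) hm)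
    refine ⟨ndHom.symm μ, piFun_ext fun i => ?_⟩
    exact (congrArg (fun ν => app ν _ i.2) (ndHom.apply_symm_apply μ)).trans (hμ i.1 i.2)
  · rintro ⟨z, rfl⟩
    refine piFun_ext fun r => sub_eq_zero.2 ?_
    change app (ndHom z) _ _ = act ((tR R).obj M) _ (app (ndHom z) _ _) + app (ndHom z) _ _
    rw [map_add, app_act]

/-- Here `D_R G` is a kernel between products of functors `- ⊗ L`. These products may be infinite,
so the argument takes place over all modules and does not yield a pp-functor. -/
lemma isFPFun_DR (G : (AddFun (FPMod R))ᵒᵖ) : isFPFun (RMod R) ((DR R).obj G) :=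
  isFPFun_of_relFP (relFP_of_ker hasWeakPushouts_top_module
    (relFP_top_of_isFPFun (isFPFun_piFun _ fun _ => isFPFun_of_relFP (relFP_tU _)))
    (relFP_top_of_isFPFun (isFPFun_piFun _ fun _ => isFPFun_of_relFP (relFP_tU _)))
    (toFamily_injective G.unop) (exactSeq_toFamily G.unop))

end DualFP

/-! ### Restriction to finitely presented modules -/

section Restriction

variable {R : Type u} [Ring R]

lemma rightExactSeq_res {F : AddFun (RMod R)} {X Y : FPMod Rᵐᵒᵖ} {g : rep Y.obj ⟶ rep X.obj}
    {p : rep X.obj ⟶ F} (h : RightExactSeq g p) :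
    RightExactSeq ((resRep R Y).inv ≫ (res R).map g ≫ (resRep R X).hom)
      ((resRep R X).inv ≫ (res R).map p) := by
  refine fun A => ⟨fun x => ?_, fun x => ?_⟩
  · refine ((h A.obj).1 x.hom).trans ?_
    constructor
    · rintro ⟨y, hy⟩
      exact ⟨ObjectProperty.homMk y, congrArg ObjectProperty.homMk hy⟩
    · rintro ⟨y, hy⟩
      exact ⟨y.hom, congrArg InducedCategory.Hom.hom hy⟩
  · obtain ⟨y, hy⟩ := (h A.obj).2 x
    exact ⟨ObjectProperty.homMk y, hy⟩

/-- Natural transformations out of a pp-functor are determined by finitely presented modules. -/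
lemma bijective_res_map (F : PP R) (H : AddFun (RMod R)) :
    Function.Bijective (fun μ : F.obj ⟶ H => (res R).map μ) := by
  obtain ⟨X, Y, g, p, h⟩ := F.property
  have h' := rightExactSeq_res h
  constructor
  -- Both sides equal the kernel of `H X ⟶ H Y`, which involves only values at the finitely
  -- presented modules `X` and `Y`.
  · intro μ ν e
    exact h.nat_ext (congrArg (fun γ => app γ X (app p X.obj (el (𝟙 X.obj)))) e)
  · intro ν
    have hν := (h'.exists_nat_iff (H := (res R).obj H) _).2 ⟨ν, rfl⟩
    obtain ⟨μ, hμ⟩ := (h.exists_nat_iff (H := H) _).1 hν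
    exact ⟨μ, h'.nat_ext hμ⟩

instance : (ppRes R).Faithful where
  map_injective {F F' _ _} e := ObjectProperty.hom_ext _
    ((bijective_res_map F F'.obj).1
      (congrArg (fun k : (ppRes R).obj F ⟶ (ppRes R).obj F' => k.hom) e))

instance : (ppRes R).Full where
  map_surjective {F F'} f := by
    obtain ⟨μ, hμ⟩ := (bijective_res_map F F'.obj).2 f.hom
    exact ⟨ObjectProperty.homMk μ, ObjectProperty.hom_ext _ hμ⟩

instance : (ppRes R).EssSurj where
  mem_essImage F := by
    obtain ⟨X, Y, g, p, h⟩ := F.property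
    -- The relation of `F` comes from a morphism of modules, so it also defines a map of
    -- representables on `Mod(R)`; the cokernel of that map restricts to `F`.
    let g' : rep Y.obj ⟶ rep X.obj := yo (el (repMap g).hom)
    let F' : PP R := ⟨cokFun g', X, Y, g', cokProj g', rightExactSeq_cokProj g'⟩
    have hg : (resRep R Y).inv ≫ (res R).map g' ≫ (resRep R X).hom = g := by
      refine rep_ext (Eq.trans ?_ (Category.comp_id (repMap g)))
      rfl
    have h' := rightExactSeq_res (rightExactSeq_cokProj g')
    rw [hg] at h'
    obtain ⟨e, -⟩ := h'.exists_iso h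
    exact ⟨F', ⟨(isFPFun _).isoMk e⟩⟩

lemma isEquivalence_ppRes : (ppRes R).IsEquivalence where

end Restriction

/-! ### The classical duality -/

section Classical

variable {R : Type u} [Ring R]

lemma evalD_add (F : AddFun (FPMod Rᵐᵒᵖ)) {X : FPMod Rᵐᵒᵖ} (x x' : ev F X) :
    evalD F (x + x') = evalD F x + evalD F x' :=
  nat_ext fun _ z => map_add (app (ndHom (T := tL R) z) X) x x'

lemma evalD_act (F : AddFun (FPMod Rᵐᵒᵖ)) {X Y : FPMod Rᵐᵒᵖ} (f : X ⟶ Y) (x : ev F X) :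
    evalD F (act F f x) = evalD F x ≫ ((isFPMod Rᵐᵒᵖ).ι ⋙ tR R).map f :=
  nat_ext fun _ z => app_act (ndHom (T := tL R) z) f x

/-- The evaluation `Nat(G, X ⊗ -) → X ⊗ L` at an element of `G L`. -/
def evalD' (G : AddFun (FPMod R)) {L : FPMod R} (y : ev G L) :
    natDualObj ((isFPMod Rᵐᵒᵖ).ι ⋙ tR R) G ⟶ (tL R).obj L :=
  (res R).map (evalDR G y)

lemma evalD'_add (G : AddFun (FPMod R)) {L : FPMod R} (y y' : ev G L) :
    evalD' G (y + y') = evalD' G y + evalD' G y' :=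
  nat_ext fun _ z => map_add (app (ndHom (T := (isFPMod Rᵐᵒᵖ).ι ⋙ tR R) z) L) y y'

lemma evalD'_act (G : AddFun (FPMod R)) {L M : FPMod R} (f : L ⟶ M) (y : ev G L) :
    evalD' G (act G f y) = evalD' G y ≫ (tL R).map f :=
  nat_ext fun _ z => app_act (ndHom (T := (isFPMod Rᵐᵒᵖ).ι ⋙ tR R) z) f y

/-- The biduality map `F ⟶ D' (D F)`. -/
def bidual (F : AddFun (FPMod Rᵐᵒᵖ)) :
    F ⟶ natDualObj ((isFPMod Rᵐᵒᵖ).ι ⋙ tR R) (natDualObj (tL R) F) :=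
  unpair (fun _ => AddMonoidHom.mk' (fun x => evalD F x) (evalD_add F)) (evalD_act F)

/-- The biduality map `G ⟶ D (D' G)`. -/
def bidual' (G : AddFun (FPMod R)) :
    G ⟶ natDualObj (tL R) (natDualObj ((isFPMod Rᵐᵒᵖ).ι ⋙ tR R) G) :=
  unpair (fun _ => AddMonoidHom.mk' (fun y => evalD' G y) (evalD'_add G)) (evalD'_act G)

lemma pair_bidual (F : AddFun (FPMod Rᵐᵒᵖ)) (X : FPMod Rᵐᵒᵖ) (x : ev F X) :
    pair (bidual F) X x = evalD F x := pair_unpair _ _ _ _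

lemma pair_bidual' (G : AddFun (FPMod R)) (L : FPMod R) (y : ev G L) :
    pair (bidual' G) L y = evalD' G y := pair_unpair _ _ _ _

/-- The biduality criterion applies because `D F` is the kernel of `X₀ ⊗ - ⟶ Y₀ ⊗ -`, whose cokernel
is `Z ⊗ -` with `Z` finitely presented. -/
lemma bijective_bidual (F : FPFun (FPMod Rᵐᵒᵖ)) (X : FPMod Rᵐᵒᵖ) :
    Function.Bijective (app (bidual F.obj) X) := by
  obtain ⟨X₀, Y₀, g, p, h⟩ := F.property
  obtain ⟨Z, q, hq, hq'⟩ := exists_cokernel (repMap g)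
  refine bijective_of_pairing hasWeakPushouts_fpMod (fun X => weakCokernelExact_tR X.obj)
    (bidual F.obj) h ?_ ?_ (isFPFun_tR Y₀) (isFPFun_tR Z) (rightExactSeq_tR hq hq') X
  · rw [pair_bidual]
    exact evalD_injective h
  · rw [pair_bidual]
    exact exactSeq_evalD h

lemma bijective_bidual' (G : FPFun (FPMod R)) (L : FPMod R) :
    Function.Bijective (app (bidual' G.obj) L) := by
  obtain ⟨L₀, M₀, g, p, h⟩ := G.property
  obtain ⟨N, q, hq, hq'⟩ := exists_cokernel (repMap g)
  refine bijective_of_pairing hasWeakPushouts_fpMod weakCokernelExact_tL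
    (bidual' G.obj) h ?_ ?_ (isFPFun_tL M₀) (isFPFun_tL N) (rightExactSeq_tL hq hq') L
  · rw [pair_bidual']
    exact fun X => evalDR_injective h X.obj
  · rw [pair_bidual']
    exact fun X => exactSeq_evalDR h X.obj

/-- `Nat(F, D' G) → Nat(G, D F)`. -/
def swapLR {F : AddFun (FPMod Rᵐᵒᵖ)} {G : AddFun (FPMod R)}
    (α : F ⟶ natDualObj ((isFPMod Rᵐᵒᵖ).ι ⋙ tR R) G) : G ⟶ natDualObj (tL R) F :=
  bidual' G ≫ (natDual (tL R)).map α.op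

/-- `Nat(G, D F) → Nat(F, D' G)`. -/
def swapRL {F : AddFun (FPMod Rᵐᵒᵖ)} {G : AddFun (FPMod R)}
    (β : G ⟶ natDualObj (tL R) F) : F ⟶ natDualObj ((isFPMod Rᵐᵒᵖ).ι ⋙ tR R) G :=
  bidual F ≫ (natDual ((isFPMod Rᵐᵒᵖ).ι ⋙ tR R)).map β.op

/-- Transposition only exchanges the arguments of the pairing `F X × G L → X ⊗ L`; bijectivity and
naturality of the adjunction follow from this. -/
lemma app_pair_swapLR {F : AddFun (FPMod Rᵐᵒᵖ)} {G : AddFun (FPMod R)}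
    (α : F ⟶ natDualObj ((isFPMod Rᵐᵒᵖ).ι ⋙ tR R) G) {X : FPMod Rᵐᵒᵖ} {L : FPMod R}
    (x : ev F X) (y : ev G L) :
    app (pair (swapLR α) L y) X x = app (pair α X x) L y := by
  have h : pair (swapLR α) L y = α ≫ pair (bidual' G) L y := ndHom_natDual_map α _
  rw [h, pair_bidual']
  rfl

lemma app_pair_swapRL {F : AddFun (FPMod Rᵐᵒᵖ)} {G : AddFun (FPMod R)}
    (β : G ⟶ natDualObj (tL R) F) {X : FPMod Rᵐᵒᵖ} {L : FPMod R}
    (x : ev F X) (y : ev G L) :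
    app (pair (swapRL β) X x) L y = app (pair β L y) X x := by
  have h : pair (swapRL β) X x = β ≫ pair (bidual F) X x := ndHom_natDual_map β _
  rw [h, pair_bidual]
  rfl

/-- The bijection `Nat(F, D' G) ≃ Nat(G, D F)`. -/
def swapEquiv (F : AddFun (FPMod Rᵐᵒᵖ)) (G : AddFun (FPMod R)) :
    (F ⟶ natDualObj ((isFPMod Rᵐᵒᵖ).ι ⋙ tR R) G) ≃ (G ⟶ natDualObj (tL R) F) where
  toFun := swapLR
  invFun := swapRL
  left_inv α := pair_ext fun _ x _ y => (app_pair_swapRL _ x y).trans (app_pair_swapLR α x y)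
  right_inv β := pair_ext fun _ y _ x => (app_pair_swapLR _ x y).trans (app_pair_swapRL β x y)

variable (R) in
/-- The adjunction between the functors `D`. -/
def classicalAdj : (D'fp R isFPFun_D').rightOp ⊣ Dfp R isFPFun_D :=
  Adjunction.mkOfHomEquiv
    { homEquiv := fun G F =>
        { toFun := fun f => ObjectProperty.homMk (swapEquiv F.unop.obj G.obj f.unop.hom)
          invFun := fun β => Quiver.Hom.op
            (ObjectProperty.homMk ((swapEquiv F.unop.obj G.obj).symm β.hom))
          left_inv := fun f => Quiver.Hom.unop_inj (ObjectProperty.hom_ext _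
            ((swapEquiv F.unop.obj G.obj).symm_apply_apply f.unop.hom))
          right_inv := fun β => ObjectProperty.hom_ext _
            ((swapEquiv F.unop.obj G.obj).apply_symm_apply β.hom) }
      homEquiv_naturality_left_symm := fun {G' G F} f β => by
        apply Quiver.Hom.unop_inj
        apply ObjectProperty.hom_ext
        refine pair_ext fun X x L y => (app_pair_swapRL _ x y).trans ?_
        have h : pair (swapRL β.hom ≫ (natDual ((isFPMod Rᵐᵒᵖ).ι ⋙ tR R)).map f.hom.op) X x =
          f.hom ≫ pair (swapRL β.hom) X x := ndHom_natDual_map f.hom _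
        refine Eq.trans ?_ (congrArg (fun μ => app μ L y) h.symm)
        exact (app_pair_swapRL β.hom x (app f.hom L y)).symm
      homEquiv_naturality_right := fun {G F F'} f α => by
        apply ObjectProperty.hom_ext
        refine pair_ext fun L y X x => (app_pair_swapLR _ x y).trans ?_
        have h : pair (swapLR f.unop.hom ≫ (natDual (tL R)).map α.unop.hom.op) L y =
          α.unop.hom ≫ pair (swapLR f.unop.hom) L y := ndHom_natDual_map α.unop.hom _
        refine Eq.trans ?_ (congrArg (fun μ => app μ X x) h.symm)
        exact (app_pair_swapLR f.unop.hom (app α.unop.hom X x) y).symm }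

lemma classicalAdj_homEquiv (G : FPFun (FPMod R)) (F : (FPFun (FPMod Rᵐᵒᵖ))ᵒᵖ)
    (f : (D'fp R isFPFun_D').rightOp.obj G ⟶ F) :
    ((classicalAdj R).homEquiv G F f).hom = swapLR f.unop.hom := by
  rw [classicalAdj, Adjunction.mkOfHomEquiv_homEquiv]
  rfl

lemma isIso_of_isIso_hom {C : Type w} [Category.{v} C] {P : ObjectProperty C}
    {X Y : P.FullSubcategory} (f : X ⟶ Y) (h : IsIso f.hom) : IsIso f := by
  have : IsIso (P.ι.map f) := h
  exact isIso_of_reflects_iso f P.ι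

/-- The unit is the transpose of the identity, whose pairing is evaluation, so it is the biduality
map. -/
instance isIso_classicalAdj_unit (G : FPFun (FPMod R)) : IsIso ((classicalAdj R).unit.app G) := by
  refine isIso_of_isIso_hom _ ?_
  have h : ((classicalAdj R).unit.app G).hom = bidual' G.obj := by
    rw [← Adjunction.homEquiv_id, classicalAdj_homEquiv]
    refine pair_ext fun L y X x => (app_pair_swapLR _ x y).trans ?_
    exact (congrArg (fun μ => app μ X x) (pair_bidual' G.obj L y)).symm
  rw [h]
  exact isIso_of_bijective _ (bijective_bidual' G)

instance isIso_classicalAdj_counit (F : (FPFun (FPMod Rᵐᵒᵖ))ᵒᵖ) :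
    IsIso ((classicalAdj R).counit.app F) := by
  have h : (((classicalAdj R).counit.app F).unop).hom = bidual F.unop.obj := by
    rw [← Adjunction.homEquiv_symm_id, classicalAdj, Adjunction.mkOfHomEquiv_homEquiv]
    refine pair_ext fun X x L y => (app_pair_swapRL _ x y).trans ?_
    exact (congrArg (fun μ => app μ L y) (pair_bidual F.unop.obj X x)).symm
  have : IsIso ((classicalAdj R).counit.app F).unop := by
    refine isIso_of_isIso_hom _ ?_
    rw [h]
    exact isIso_of_bijective _ (bijective_bidual F.unop)
  exact (isIso_unop_iff _).1 this

lemma isEquivalence_Dfp : (Dfp R isFPFun_D).IsEquivalence :=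
  (classicalAdj R).toEquivalence.isEquivalence_inverse

lemma isEquivalence_D'fp : (D'fp R isFPFun_D').IsEquivalence := by
  have : (D'fp R isFPFun_D').rightOp.IsEquivalence :=
    (classicalAdj R).toEquivalence.isEquivalence_functor
  exact (inferInstance : (D'fp R isFPFun_D').rightOp.leftOp.IsEquivalence)

end Classical

/-! ### The functor `D_A` in terms of natural transformations on all modules -/

section DA

/-- `DA` is built from the categorical kernel; comparison with the pointwise kernel `kerFun` gives
access to its elements. -/
lemma exactSeq_kernel_ι {J : Type w} [Category.{u} J] [Preadditive J] {F G : AddFun J}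
    (f : F ⟶ G) : (∀ A, Function.Injective (app (kernel.ι f) A)) ∧ ExactSeq (kernel.ι f) f := by
  obtain ⟨γ, hγ⟩ := exists_lift (kerIncl_injective f) (exactSeq_kerIncl f) (kernel.ι f)
    (kernel.condition f)
  let δ : kerFun f ⟶ kernel f := kernel.lift f (kerIncl f) (exactSeq_kerIncl f).comp_eq_zero
  have hδ : δ ≫ kernel.ι f = kerIncl f := kernel.lift_ι _ _ _
  have hγδ : γ ≫ δ = 𝟙 _ := by
    rw [← cancel_mono (kernel.ι f), Category.assoc, hδ, hγ, Category.id_comp]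
  refine ⟨fun A => (injective_iff_map_eq_zero _).2 fun x hx => ?_, fun A y => ⟨fun hy => ?_, ?_⟩⟩
  · have h0 : app γ A x = 0 := kerIncl_injective f A (by
      rw [← app_comp, hγ, hx, map_zero])
    rw [← app_id (F := kernel f) A x, ← hγδ, app_comp, h0, map_zero]
  · obtain ⟨z, rfl⟩ := (exactSeq_kerIncl f A y).1 hy
    exact ⟨app δ A z, by rw [← app_comp, hδ]⟩
  · rintro ⟨x, rfl⟩
    rw [← app_comp, kernel.condition, app_zero]

variable {R : Type u} [Ring R]

variable (R) in
/-- The contravariant functor `t ∘ w`. -/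
abbrev tw : (FPFun (RMod R))ᵒᵖ ⥤ AddFun (FPMod R) := (w (RMod R)).leftOp ⋙ tR R

/-- The module `w A`. -/
abbrev wObj (A : FPFun (RMod R)) : RMod R := ((w (RMod R)).obj A).unop

/-- The unit `A ⟶ (w A, -)`. -/
def unitW (A : FPFun (RMod R)) : A.obj ⟶ rep (wObj A) := ((wAdj (RMod R)).unit.app A).hom

lemma unitW_naturality {A A' : FPFun (RMod R)} (α : A ⟶ A') :
    α.hom ≫ unitW A' = unitW A ≫ yo (el ((w (RMod R)).map α).unop) :=
  congrArg (fun k : A ⟶ (yon (RMod R)).obj ((w (RMod R)).obj A') => k.hom)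
    ((wAdj (RMod R)).unit.naturality α)

/-- The right adjoint `yon` is fully faithful, so the unit is invertible on its image. -/
instance (X : (RMod R)ᵒᵖ) : IsIso (unitW ((yon (RMod R)).obj X)) :=
  (inferInstance :
    IsIso ((isFPFun _).ι.map ((wAdj (RMod R)).unit.app ((yon (RMod R)).obj X))))

/-- The elements of `w A ⊗ L`. -/
def twEquiv (A : FPFun (RMod R)) (L : FPMod R) :
    ev ((tw R).obj (op A)) L ≃+ ev ((tU R).obj L) (wObj A) := AddEquiv.refl _

lemma twEquiv_map {A A' : FPFun (RMod R)} (α : A ⟶ A') (L : FPMod R)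
    (s : ev ((tw R).obj (op A')) L) :
    twEquiv A L (app ((tw R).map α.op) L s) =
      act ((tU R).obj L) ((w (RMod R)).map α).unop (twEquiv A' L s) := rfl

lemma twEquiv_act (A : FPFun (RMod R)) {L L' : FPMod R} (l : L ⟶ L')
    (s : ev ((tw R).obj (op A)) L) :
    twEquiv A L' (act ((tw R).obj (op A)) l s) =
      app ((tU R).map l) (wObj A) (twEquiv A L s) := rfl

lemma yo_add {C : Type w} [Category.{v} C] [Preadditive C] {F : AddFun C} {A : C} (x y : ev F A) :
    (yo (x + y) : rep A ⟶ F) = yo x + yo y :=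
  nat_ext fun _ h => map_add (act F h) x y

lemma yo_el_comp_yo {C : Type w} [Category.{v} C] [Preadditive C] {F : AddFun C} {A B : C}
    (f : A ⟶ B) (x : ev F A) : yo (el f) ≫ yo x = yo (act F f x) := yo_comp _ _

/-- The natural transformation `A ⟶ - ⊗ L` given by an element of `w A ⊗ L`. -/
def ofW (A : FPFun (RMod R)) (L : FPMod R) :
    ev ((tw R).obj (op A)) L →+ (A.obj ⟶ (tU R).obj L) :=
  AddMonoidHom.mk' (fun s => unitW A ≫ yo (twEquiv A L s)) fun s t => by
    rw [map_add, yo_add, Preadditive.comp_add]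

lemma ofW_apply (A : FPFun (RMod R)) (L : FPMod R) (s : ev ((tw R).obj (op A)) L) :
    ofW A L s = unitW A ≫ yo (twEquiv A L s) := rfl

lemma ofW_map {A A' : FPFun (RMod R)} (α : A ⟶ A') (L : FPMod R)
    (s : ev ((tw R).obj (op A')) L) :
    ofW A L (app ((tw R).map α.op) L s) = α.hom ≫ ofW A' L s := by
  rw [ofW_apply, ofW_apply, ← Category.assoc, unitW_naturality, Category.assoc, yo_el_comp_yo,
    twEquiv_map]

lemma ofW_act (A : FPFun (RMod R)) {L L' : FPMod R} (l : L ⟶ L')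
    (s : ev ((tw R).obj (op A)) L) :
    ofW A L' (act ((tw R).obj (op A)) l s) = ofW A L s ≫ (tU R).map l := by
  rw [ofW_apply, ofW_apply, Category.assoc, yo_comp, twEquiv_act]

/-- On representables the unit is invertible, and what remains is the Yoneda lemma for `- ⊗ L` at `w
A`. -/
lemma bijective_ofW_yon (X : (RMod R)ᵒᵖ) (L : FPMod R) :
    Function.Bijective (ofW ((yon (RMod R)).obj X) L) := by
  constructor
  · intro s t e
    rw [ofW_apply, ofW_apply, cancel_epi] at e
    have := congrArg (fun μ => app μ _ (el (𝟙 _))) e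
    simp only [app_yo, act_id] at this
    exact (twEquiv _ L).injective this
  · intro μ
    refine ⟨(twEquiv _ L).symm (app (inv (unitW _) ≫ μ) _ (el (𝟙 _))), ?_⟩
    rw [ofW_apply, AddEquiv.apply_symm_apply, ← IsIso.eq_inv_comp]
    exact rep_ext ((app_yo _ _).trans (act_id _ _))

/-- The inclusion of `D_A F` into the value of `t ∘ w` on a representable functor. -/
def inclDA (F : FPFun (RMod R)) :
    (DA R).obj (op F) ⟶ (tw R).obj (op ((yon (RMod R)).obj (op (pres F).X))) :=
  kernel.ι ((tw R).map (pres F).g.op)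

lemma inclDA_injective (F : FPFun (RMod R)) (L : FPMod R) :
    Function.Injective (app (inclDA F) L) :=
  (exactSeq_kernel_ι ((tw R).map (pres F).g.op)).1 L

lemma exactSeq_inclDA (F : FPFun (RMod R)) : ExactSeq (inclDA F) ((tw R).map (pres F).g.op) :=
  (exactSeq_kernel_ι ((tw R).map (pres F).g.op)).2

/-- The lift chosen inside `R0` is retained only through the two properties needed for the
naturality of `theta`. -/
lemma exists_lift_map_inclDA {F F' : FPFun (RMod R)} (α : F ⟶ F') :
    ∃ a : (yon (RMod R)).obj (op (pres F).X) ⟶ (yon (RMod R)).obj (op (pres F').X),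
      a ≫ (pres F').p = (pres F).p ≫ α ∧
      (DA R).map α.op ≫ inclDA F = inclDA F' ≫ (tw R).map a.op :=
  ⟨_, ((pres F').exists_lift ((pres F).p ≫ α)).choose_spec, kernel.lift_ι _ _ _⟩

/-- An element of the kernel defining `D_A F` gives a map on `(X, -)` that vanishes on the
relations, so it descends along `p`. -/
lemma exists_theta (F : FPFun (RMod R)) (L : FPMod R) (a : ev ((DA R).obj (op F)) L) :
    ∃ μ : F.obj ⟶ (tU R).obj L, (pres F).p.hom ≫ μ = ofW _ L (app (inclDA F) L a) := by
  refine exists_desc (pres F).exact _ ?_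
  rw [← ofW_map, ← app_comp, (exactSeq_inclDA F).comp_eq_zero, app_zero, map_zero]

lemma pres_ext {F : FPFun (RMod R)} {H : AddFun (RMod R)} {μ ν : F.obj ⟶ H}
    (h : (pres F).p.hom ≫ μ = (pres F).p.hom ≫ ν) : μ = ν :=
  surj_ext (fun A => ((pres F).exact A).2) h

/-- The identification of `D_A F (L)` with `Nat(F, - ⊗ L)`. -/
def theta (F : FPFun (RMod R)) (L : FPMod R) :
    ev ((DA R).obj (op F)) L →+ (F.obj ⟶ (tU R).obj L) :=
  AddMonoidHom.mk' (fun a => (exists_theta F L a).choose) fun a b => pres_ext (by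
    rw [Preadditive.comp_add, (exists_theta F L (a + b)).choose_spec,
      (exists_theta F L a).choose_spec, (exists_theta F L b).choose_spec, map_add, map_add])

lemma theta_spec (F : FPFun (RMod R)) (L : FPMod R) (a : ev ((DA R).obj (op F)) L) :
    (pres F).p.hom ≫ theta F L a = ofW _ L (app (inclDA F) L a) :=
  (exists_theta F L a).choose_spec

/-- Under `ofW`, bijective on the two terms of the presentation, both sides are the kernel of
`Nat(P₀, - ⊗ L) ⟶ Nat(P₁, - ⊗ L)`. -/
lemma bijective_theta (F : FPFun (RMod R)) (L : FPMod R) : Function.Bijective (theta F L) := by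
  constructor
  · intro a b e
    apply inclDA_injective F L
    apply (bijective_ofW_yon _ L).1
    rw [← theta_spec, e, theta_spec]
  · intro μ
    obtain ⟨s, hs⟩ := (bijective_ofW_yon _ L).2 ((pres F).p.hom ≫ μ)
    have h0 : app ((tw R).map (pres F).g.op) L s = 0 := by
      apply (bijective_ofW_yon _ L).1
      rw [ofW_map, hs, ← Category.assoc, map_zero]
      exact nat_ext fun A x => (congrArg (app μ A)
        (((pres F).exact A).1.apply_apply_eq_zero x)).trans (map_zero _)
    obtain ⟨a, rfl⟩ := (exactSeq_inclDA F L s).1 h0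
    exact ⟨a, pres_ext ((theta_spec F L a).trans hs)⟩

lemma theta_act (F : FPFun (RMod R)) {L L' : FPMod R} (l : L ⟶ L')
    (a : ev ((DA R).obj (op F)) L) :
    theta F L' (act ((DA R).obj (op F)) l a) = theta F L a ≫ (tU R).map l := by
  apply pres_ext
  rw [theta_spec, app_act, ofW_act, ← theta_spec, Category.assoc]

lemma theta_map {F F' : FPFun (RMod R)} (α : F ⟶ F') (L : FPMod R)
    (b : ev ((DA R).obj (op F')) L) :
    theta F L (app ((DA R).map α.op) L b) = α.hom ≫ theta F' L b := by
  obtain ⟨a, ha, ha'⟩ := exists_lift_map_inclDA α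
  apply pres_ext
  have ha₀ : a.hom ≫ (pres F').p.hom = (pres F).p.hom ≫ α.hom :=
    congrArg (fun k : (yon (RMod R)).obj (op (pres F).X) ⟶ F' => k.hom) ha
  rw [theta_spec, ← app_comp, ha', app_comp, ofW_map, ← theta_spec, ← Category.assoc, ha₀,
    Category.assoc]

/-- `theta` as an isomorphism of groups. -/
def thetaEquiv (F : FPFun (RMod R)) (L : FPMod R) :
    ev ((DA R).obj (op F)) L ≃+ (F.obj ⟶ (tU R).obj L) :=
  AddEquiv.ofBijective (theta F L) (bijective_theta F L)

lemma theta_thetaEquiv_symm (F : FPFun (RMod R)) (L : FPMod R) (μ : F.obj ⟶ (tU R).obj L) :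
    theta F L ((thetaEquiv F L).symm μ) = μ :=
  (thetaEquiv F L).apply_symm_apply μ

/-! ### The adjunction between `D_R` and `D_A` -/

/-- The evaluation `D_A F (L) → M ⊗ L` at an element of `F M`. -/
def evalDA (F : FPFun (RMod R)) {M : RMod R} (x : ev F.obj M) :
    (DA R).obj (op F) ⟶ (tR R).obj M :=
  mkNat (fun L => AddMonoidHom.mk' (fun a => app (theta F L a) M x) fun a b => by
      rw [map_add, app_add]
      rfl)
    fun f a => congrArg (fun μ => app μ M x) (theta_act F f a)

/-- The biduality map `F ⟶ D_R (D_A F)`. -/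
def bidualDA (F : FPFun (RMod R)) : F.obj ⟶ natDualObj (tR R) ((DA R).obj (op F)) :=
  unpair (fun M => AddMonoidHom.mk' (fun x => evalDA F x) fun x y =>
      nat_ext fun L a => map_add (app (theta F L a) M) x y)
    fun f x => nat_ext fun L a => app_act (theta F L a) f x

lemma pair_bidualDA (F : FPFun (RMod R)) (M : RMod R) (x : ev F.obj M) :
    pair (bidualDA F) M x = evalDA F x := ndHom.apply_symm_apply (evalDA F x)

/-- Since `theta` describes `D_A F` without reference to a presentation, the chosen `pres`, possibly
by large modules, can be replaced by one with `X` and `Y` finitely presented. Then `D_A F` is the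
kernel of `X ⊗ - ⟶ Y ⊗ -`, and the biduality criterion applies with `M` ranging over all modules. -/
lemma bijective_bidualDA (F : PP R) (M : RMod R) :
    Function.Bijective (app (bidualDA ((ppIncl R).obj F)) M) := by
  obtain ⟨X, Y, g, p, h⟩ := F.property
  obtain ⟨Z, q, hq, hq'⟩ := exists_cokernel (S := Rᵐᵒᵖ) (L := X) (M := Y)
    (ObjectProperty.homMk (repMap g))
  refine bijective_of_pairing hasWeakPushouts_fpMod weakCokernelExact_tR
    (bidualDA ((ppIncl R).obj F)) h ?_ ?_ (isFPFun_tR Y) (isFPFun_tR Z) (rightExactSeq_tR hq hq') M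
  · rw [pair_bidualDA]
    exact fun L a b e => (bijective_theta _ L).1 (h.nat_ext e)
  · rw [pair_bidualDA]
    intro L t
    refine (h.exists_nat_iff (H := (tU R).obj L) t).trans ?_
    constructor
    · rintro ⟨μ, hμ⟩
      obtain ⟨a, rfl⟩ := (bijective_theta ((ppIncl R).obj F) L).2 μ
      exact ⟨a, hμ⟩
    · rintro ⟨a, ha⟩
      exact ⟨theta ((ppIncl R).obj F) L a, ha⟩

/-- `Nat(F, D_R G) → Nat(G, D_A F)`. -/
def adjLR {F : FPFun (RMod R)} {G : AddFun (FPMod R)} (α : F.obj ⟶ natDualObj (tR R) G) :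
    G ⟶ (DA R).obj (op F) :=
  mkNat (fun L => (thetaEquiv F L).symm.toAddMonoidHom.comp
    (AddMonoidHom.mk' (fun y => α ≫ evalDR G y) fun y y' =>
      nat_ext fun M x => map_add (app (ndHom (app α M x)) L) y y'))
    fun {L L'} l y => (bijective_theta F L').1 (by
      rw [theta_act]
      refine (theta_thetaEquiv_symm F L' _).trans ?_
      refine Eq.trans ?_ (congrArg (· ≫ (tU R).map l) (theta_thetaEquiv_symm F L _)).symm
      exact nat_ext fun M x => app_act (ndHom (app α M x)) l y)

lemma theta_adjLR {F : FPFun (RMod R)} {G : AddFun (FPMod R)}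
    (α : F.obj ⟶ natDualObj (tR R) G) {L : FPMod R} (y : ev G L) :
    theta F L (app (adjLR α) L y) = α ≫ evalDR G y :=
  theta_thetaEquiv_symm F L _

/-- `Nat(G, D_A F) → Nat(F, D_R G)`. -/
def adjRL {F : FPFun (RMod R)} {G : AddFun (FPMod R)} (β : G ⟶ (DA R).obj (op F)) :
    F.obj ⟶ natDualObj (tR R) G :=
  bidualDA F ≫ (natDual (tR R)).map β.op

lemma pair_adjRL {F : FPFun (RMod R)} {G : AddFun (FPMod R)} (β : G ⟶ (DA R).obj (op F))
    {M : RMod R} (x : ev F.obj M) : pair (adjRL β) M x = β ≫ evalDA F x := by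
  rw [← pair_bidualDA]
  exact ndHom_natDual_map β _

/-- The bijection `Nat(F, D_R G) ≃ Nat(G, D_A F)`. -/
def adjEquiv (F : FPFun (RMod R)) (G : AddFun (FPMod R)) :
    (F.obj ⟶ natDualObj (tR R) G) ≃ (G ⟶ (DA R).obj (op F)) where
  toFun := adjLR
  invFun := adjRL
  left_inv α := pair_ext fun M x L y => by
    rw [pair_adjRL]
    exact congrArg (fun μ => app μ M x) (theta_adjLR α y)
  right_inv β := nat_ext fun L y => (bijective_theta F L).1 ((theta_adjLR _ y).trans
    (nat_ext fun M x => congrArg (fun μ => app μ L y) (pair_adjRL β x)))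

variable (R) in
/-- The adjunction between `D_R` and `D_A`. -/
def adjDRDA : (DRfp R isFPFun_DR).rightOp ⊣ DA R :=
  Adjunction.mkOfHomEquiv
    { homEquiv := fun G F =>
        { toFun := fun f => adjEquiv F.unop G f.unop.hom
          invFun := fun β => Quiver.Hom.op
            (ObjectProperty.homMk ((adjEquiv F.unop G).symm β))
          left_inv := fun f => Quiver.Hom.unop_inj (ObjectProperty.hom_ext _
            ((adjEquiv F.unop G).symm_apply_apply f.unop.hom))
          right_inv := fun β => (adjEquiv F.unop G).apply_symm_apply β }
      homEquiv_naturality_left_symm := fun {G' G F} f β => by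
        apply Quiver.Hom.unop_inj
        apply ObjectProperty.hom_ext
        refine pair_ext fun M x L y => ?_
        have h : pair (adjRL β ≫ (natDual (tR R)).map f.op) M x =
          f ≫ pair (adjRL β) M x := ndHom_natDual_map f _
        refine Eq.trans ?_ (congrArg (fun μ => app μ L y) h.symm)
        refine (congrArg (fun μ => app μ L y) (pair_adjRL (f ≫ β) x)).trans ?_
        exact (congrArg (fun μ => app μ L (app f L y)) (pair_adjRL β x)).symm
      homEquiv_naturality_right := fun {G F F'} f α => by
        refine nat_ext fun L y => (bijective_theta F'.unop L).1 ?_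
        refine (theta_adjLR _ y).trans ?_
        refine Eq.trans ?_ (theta_map α.unop L _).symm
        exact congrArg (α.unop.hom ≫ ·) (theta_adjLR f.unop.hom y).symm }

lemma adjDRDA_homEquiv (G : AddFun (FPMod R)) (F : (FPFun (RMod R))ᵒᵖ)
    (f : (DRfp R isFPFun_DR).rightOp.obj G ⟶ F) :
    (adjDRDA R).homEquiv G F f = adjLR f.unop.hom := by
  rw [adjDRDA, Adjunction.mkOfHomEquiv_homEquiv]
  rfl

/-- The transpose of the identity of `D_A F` is the biduality map `F ⟶ D_R D_A F`. -/
lemma isIso_adjDRDA_counit (F : PP R) :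
    IsIso ((adjDRDA R).counit.app (op ((ppIncl R).obj F))) := by
  have h : (((adjDRDA R).counit.app (op ((ppIncl R).obj F))).unop).hom =
      bidualDA ((ppIncl R).obj F) := by
    rw [← Adjunction.homEquiv_symm_id, adjDRDA, Adjunction.mkOfHomEquiv_homEquiv]
    refine pair_ext fun M x L y => ?_
    refine (congrArg (fun μ => app μ L y) (pair_adjRL (𝟙 _) x)).trans ?_
    exact (congrArg (fun μ => app μ L y) (pair_bidualDA ((ppIncl R).obj F) M x)).symm
  have : IsIso ((adjDRDA R).counit.app (op ((ppIncl R).obj F))).unop := by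
    refine isIso_of_isIso_hom _ ?_
    rw [h]
    exact isIso_of_bijective _ (bijective_bidualDA F)
  exact (isIso_unop_iff _).1 this

/-! ### Comparison with the classical duality -/

/-- The restriction map `D_A F ⟶ D (F restricted to finitely presented modules)`. -/
def toD (F : FPFun (RMod R)) : (DA R).obj (op F) ⟶ natDualObj (tL R) ((res R).obj F.obj) :=
  unpair (fun L => AddMonoidHom.mk' (fun a => (res R).map (theta F L a)) fun a b => by
      rw [map_add]
      rfl)
    fun f a => congrArg (fun μ => (res R).map μ) (theta_act F f a)

lemma pair_toD (F : FPFun (RMod R)) (L : FPMod R) (a : ev ((DA R).obj (op F)) L) :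
    pair (toD F) L a = (res R).map (theta F L a) :=
  (ndHom (T := tL R)).apply_symm_apply ((res R).map (theta F L a))

/-- The map is `theta` followed by restriction `Nat(F, - ⊗ L) → Nat(F|, - ⊗ L|)`, and the latter is
bijective because `F` is a pp-functor. -/
lemma bijective_toD (F : FPFun (RMod R)) (hF : isPP R F.obj) (L : FPMod R) :
    Function.Bijective (app (toD F) L) := by
  have h : Function.Bijective (pair (toD F) L) := by
    have e : ⇑(pair (toD F) L) =
        (fun μ : F.obj ⟶ (tU R).obj L => (res R).map μ) ∘ theta F L :=
      funext fun a => pair_toD F L a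
    rw [e]
    exact (bijective_res_map ⟨F.obj, hF⟩ _).comp (bijective_theta F L)
  exact (EquivLike.comp_bijective (app (toD F) L) ndHom).1 h

lemma toD_naturality {F F' : FPFun (RMod R)} (α : F ⟶ F') :
    (DA R).map α.op ≫ toD F = toD F' ≫ (natDual (tL R)).map ((res R).map α.hom).op := by
  refine nat_ext fun L a => ndHom.injective ?_
  have h₁ := pair_toD F L (app ((DA R).map α.op) L a)
  rw [theta_map, CategoryTheory.Functor.map_comp, ← pair_toD] at h₁
  exact h₁.trans (ndHom_natDual_map (T := tL R) ((res R).map α.hom) (app (toD F') L a)).symm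

/-- On pp-functors, `D_A` is the classical functor `D`. -/
def isoD (F : PP R) :
    (DA R).obj (op ((ppIncl R).obj F)) ≅ natDualObj (tL R) ((res R).obj F.obj) :=
  isoOfBijective (toD ((ppIncl R).obj F)) (bijective_toD _ F.property)

lemma isFPFun_DA (F : PP R) : isFPFun (FPMod R) ((DA R).obj (op ((ppIncl R).obj F))) :=
  isFPFun_of_relFP (relFP_of_iso (isoD F).symm
    (relFP_top_of_isFPFun (isFPFun_D ((ppRes R).obj F))))

variable (R) in
/-- The natural isomorphism between `D_A` and `D` on pp-functors. -/
def isoDApp : DApp R isFPFun_DA ≅ (ppRes R).op ⋙ Dfp R isFPFun_D :=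
  NatIso.ofComponents (fun F => (isFPFun _).isoMk (isoD F.unop)) fun α =>
    ObjectProperty.hom_ext _ (toD_naturality ((ppIncl R).map α.unop))

/-- Both sides have the pairing of `α` at finitely presented modules, with arguments exchanged. This
is the compatibility of the two adjunctions. -/
lemma adjLR_comp_toD {F : FPFun (RMod R)} {G : AddFun (FPMod R)}
    (α : F.obj ⟶ natDualObj (tR R) G) : adjLR α ≫ toD F = swapLR ((res R).map α) := by
  refine pair_ext fun L y X x => ?_
  refine (congrArg (fun μ => app μ X x) (pair_toD F L (app (adjLR α) L y))).trans ?_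
  rw [theta_adjLR]
  exact (app_pair_swapLR ((res R).map α) x y).symm

lemma adjLR_eq_swapLR_comp {F : PP R} {G : AddFun (FPMod R)}
    (α : F.obj ⟶ natDualObj (tR R) G) :
    adjLR (F := (ppIncl R).obj F) α = swapLR ((res R).map α) ≫ (isoD F).inv :=
  (Iso.eq_comp_inv _).2 (adjLR_comp_toD (F := (ppIncl R).obj F) α)

lemma isIso_adjLR {F : FPFun (RMod R)} (hF : isPP R F.obj) {G : AddFun (FPMod R)}
    (α : F.obj ⟶ natDualObj (tR R) G) (h : IsIso (swapLR ((res R).map α))) :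
    IsIso (adjLR α) := by
  have : IsIso (toD F) := isIso_of_bijective _ (bijective_toD F hF)
  rw [← adjLR_comp_toD] at h
  exact IsIso.of_isIso_comp_right (adjLR α) (toD F)

lemma swapLR_id (G : AddFun (FPMod R)) :
    swapLR (𝟙 (natDualObj ((isFPMod Rᵐᵒᵖ).ι ⋙ tR R) G)) = bidual' G :=
  (congrArg (bidual' G ≫ ·) ((natDual (tL R)).map_id
    (op (natDualObj ((isFPMod Rᵐᵒᵖ).ι ⋙ tR R) G)))).trans (Category.comp_id _)

/-- As `D_R G` is a pp-functor, `toD` is invertible there and turns the unit into the classical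
biduality map of `G`. -/
lemma isIso_adjDRDA_unit (G : FPFun (FPMod R)) : IsIso ((adjDRDA R).unit.app G.obj) := by
  rw [← Adjunction.homEquiv_id, adjDRDA_homEquiv]
  refine isIso_adjLR (F := (DRfp R isFPFun_DR).obj (op G.obj)) (isPP_DR G)
    (𝟙 (natDualObj (tR R) G.obj)) ?_
  have h : IsIso (bidual' G.obj) := isIso_of_bijective _ (bijective_bidual' G)
  rw [← swapLR_id] at h
  exact h

end DA

end AGJ

end

/-! ### The main theorem -/

theorem mainTheorem10 (R : Type u) [Ring R] :
    -- restriction to finitely presented modules is an equivalence `pp(Mod(R), Ab) ≃ fp(mod(R), Ab)`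
    (AGJ.ppRes R).IsEquivalence ∧
    -- `D_R` takes values in `fp(Mod(R), Ab)`; all the functors restrict as they should
    ∃ (hDR : ∀ G, AGJ.isFPFun (AGJ.RMod R) ((AGJ.DR R).obj G))
      (hDRpp : ∀ G : AGJ.FPFun (AGJ.FPMod R), AGJ.isPP R ((AGJ.DR R).obj (op G.obj)))
      (hDApp : ∀ F : AGJ.PP R,
        AGJ.isFPFun (AGJ.FPMod R) ((AGJ.DA R).obj (op ((AGJ.ppIncl R).obj F))))
      (hD : ∀ F : AGJ.FPFun (AGJ.FPMod Rᵐᵒᵖ),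
        AGJ.isFPFun (AGJ.FPMod R) ((AGJ.D R).obj (op F.obj)))
      (hD' : ∀ G : AGJ.FPFun (AGJ.FPMod R),
        AGJ.isFPFun (AGJ.FPMod Rᵐᵒᵖ) ((AGJ.D' R).obj (op G.obj)))
      -- the adjunction `Nat(F, D_R G) ≅ Nat(G, D_A F)`
      (adj : (AGJ.DRfp R hDR).rightOp ⊣ AGJ.DA R)
      -- the adjunction `Nat(F, D' G) ≅ Nat(G, D F)` of the classical duality
      (adjD : (AGJ.D'fp R hD').rightOp ⊣ AGJ.Dfp R hD)
      -- on pp-functors, `D_A` is the classical functor `D`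
      (φ : (AGJ.ppRes R).op ⋙ AGJ.Dfp R hD ≅ AGJ.DApp R hDApp),
      -- `D` and `D'` are equivalences, i.e. `fp(mod(R), Ab) ≃ fp(mod(Rᵒᵖ), Ab)ᵒᵖ`
      (AGJ.Dfp R hD).IsEquivalence ∧ (AGJ.D'fp R hD').IsEquivalence ∧
      -- the adjunction `(D_R, D_A)` restricts to an equivalence
      (∀ G : AGJ.FPFun (AGJ.FPMod R), IsIso (adj.unit.app G.obj)) ∧
      (∀ F : AGJ.PP R, IsIso (adj.counit.app (op ((AGJ.ppIncl R).obj F)))) ∧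
      -- under the identifications, the restricted adjunction is that of the classical duality
      ∀ (F : AGJ.PP R) (G : AGJ.FPFun (AGJ.FPMod R))
        (α : F ⟶ (AGJ.DRpp R hDRpp).obj (op G)),
        adj.homEquiv G.obj (op ((AGJ.ppIncl R).obj F))
            (Quiver.Hom.op (ObjectProperty.homMk α.hom :
              (AGJ.ppIncl R).obj F ⟶ (AGJ.DRfp R hDR).obj (op G.obj))) =
          (adjD.homEquiv G (op ((AGJ.ppRes R).obj F))
              ((AGJ.ppRes R).map α ≫ (AGJ.resDRpp R hDRpp hD').hom.app (op G)).op ≫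
            φ.hom.app (op F)).hom := by
  refine ⟨AGJ.isEquivalence_ppRes, AGJ.isFPFun_DR, AGJ.isPP_DR, AGJ.isFPFun_DA, AGJ.isFPFun_D,
    AGJ.isFPFun_D', AGJ.adjDRDA R, AGJ.classicalAdj R, (AGJ.isoDApp R).symm,
    AGJ.isEquivalence_Dfp, AGJ.isEquivalence_D'fp, AGJ.isIso_adjDRDA_unit,
    AGJ.isIso_adjDRDA_counit, fun F G α => ?_⟩
  rw [AGJ.adjDRDA_homEquiv]
  refine (AGJ.adjLR_eq_swapLR_comp α.hom).trans ?_
  have h := AGJ.classicalAdj_homEquiv G (op ((AGJ.ppRes R).obj F))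
    ((AGJ.ppRes R).map α ≫ (AGJ.resDRpp R AGJ.isPP_DR AGJ.isFPFun_D').hom.app (op G)).op
  -- `resDRpp` is an identity isomorphism, so composing with it leaves the restriction of `α`.
  have h' : ((AGJ.ppRes R).map α ≫
      (AGJ.resDRpp R AGJ.isPP_DR AGJ.isFPFun_D').hom.app (op G)).hom = (AGJ.res R).map α.hom :=
    Category.comp_id _
  exact congrArg (· ≫ (AGJ.isoD F).inv) (h.trans (congrArg AGJ.swapLR h')).symm
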